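/- Let $\mathcal G$ be the set of Lipschitz functions $f:\mathbb R\to\mathbb R$, with Lipschitz constant $L_f$, equipped with a $\sigma$-algebra for which the evaluations $f\mapsto f(x)$ are measurable (for instance the Borel $\sigma$-algebra of the norm $|f(0)|+L_f$). Let $\nu$ be a probability measure on $\mathcal G$, $f\sim\nu$, and let $z_0\in\mathbb R$ with $\mathbf E|f(z_0)-z_0|<\infty$. For a sequence $(g_n)_{n\ge1}$ in $\mathcal G$ write $g^{1\uparrow n}=g_1\circ\dots\circ g_n$, $g^{1\uparrow0}=\mathrm{Id}$, and $g^{1\uparrow\infty}(z_0)=\lim_n g^{1\uparrow n}(z_0)$ when the limit exists. Let $Z_\infty=f^{1\uparrow\infty}(z_0)$ for i.i.d. $f_1,f_2,\dots\sim\nu$, and let $K=\operatorname{supp}Z_\infty$ be the support of its law. Let $\mathcal P$ be a Poisson process on $[0,\infty)\times[0,\infty)\times\mathcal G$ with intensity $\mathrm{Leb}\otimes\mathrm{Leb}\otimes\nu$. For $x>0$ enumerate the points $(t_k,x_k,f_k)$ of $\mathcal P$ with $x_k\le x$ so that $t_1<t_2<\cdots$, let $N(t)=\sup\{k\ge 1:t_k\le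 t\}$ ($\sup\varnothing=0$), and let $\zeta(x)=\lim_{t\to\infty}f_1\circ\dots\circ f_{N(t)}(z_0)$. Assume: (i) (Deterministic contraction and compactness.) There are a set $\mathcal F\subset\mathcal G$ of realisations of $f$, i.e. $f\in\mathcal F$ almost surely, and a constant $c_f<1$, such that every element of $\mathcal F$ has Lipschitz constant at most $c_f$ and maps $K$ into $K$; and $K$ is compact. (ii) (Recovery property.) For every $z\in K$ there is exactly one sequence $(g^z_n)_{n\ge1}$ in $\mathcal F$ with $z=(g^z)^{1\uparrow\infty}(z_0)$, and $z\mapsto g^z_n$, $z\in K$, extends for each $n$ to a measurable map from $\mathbb R$ to $\mathcal G$. Then: (a) For $\delta>0$ and $z\in K$, let $q^\uparrow_\delta(z,\cdot)$ be the law of the infinite iteration, started at $z_0$, of the sequence obtained from $(g^z_n)_{n\ge 1}$ by inserting, before each $g^z_n$, a random number of independent copies of $f$, these numbers being independent with $\mathbf P\{m\}=(1-e^{-\delta})^m e^{-\delta}$, $m\ge0$; let $q^\downarrow_\delta(z,\cdot)$ be the law of the infinite iteration obtained by deleting each $g^z_n$ independently with probability $1-e^{-\delta}$. Then, for all $t\in\mathbb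 R$ and $\delta>0$, $\zeta(e^t)\in K$ almost surely, and $q^\uparrow_\delta$ and $q^\downarrow_\delta$ are regular conditional distributions of $\zeta(e^{t+\delta})$, respectively $\zeta(e^{t-\delta})$, given $\zeta(e^t)=z$. (b) For every $z\in K$ and $k\ge0$, the maps $g^z_{k+1}$ and $(g^z)^{1\uparrow k}$ are injective on $K$, $z\in (g^z)^{1\uparrow k}(K)$, and $((g^z)^{1\uparrow k})^{-1}(z)\in g^z_{k+1}(K)$, where inverses are those of the maps restricted to $K$. (c) Let $h\in C^1(K)$ and $z\in K$, and define the forward and reverse generators of $\zeta(e^t)$ by $$(\mathsf A_\uparrow h)(z)=\lim_{\delta\downarrow0}\frac1\delta\Big[\int h\,dq^\uparrow_\delta(z,\cdot)-h(z)\Big],\qquad (\mathsf A_\downarrow h)(z)=\lim_{\delta\downarrow0}\frac1\delta\Big[\int h\,dq^\downarrow_\delta(z,\cdot)-h(z)\Big],$$ that is, with $\mathbf E(h(\zeta(e^{t\pm\delta}))\mid\zeta(e^t)=z)$ in place of the integrals. Then both limits exist and $$(\mathsf A_\uparrow h)(z)=\sum_{k=0}^\infty\Big[\mathbf E\,h\big((g^z)^{1\uparrow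 k}\circ f\circ((g^z)^{1\uparrow k})^{-1}(z)\big)-h(z)\Big],$$ $$(\mathsf A_\downarrow h)(z)=\sum_{k=1}^\infty\Big[h\big((g^z)^{1\uparrow(k-1)}\circ(g^z_k)^{-1}\circ((g^z)^{1\uparrow(k-1)})^{-1}(z)\big)-h(z)\Big],$$ where all expectations and integrals exist and both series converge absolutely. -/

import Mathlib

open MeasureTheory ProbabilityTheory Filter Topology Set

noncomputable section

/-- A Lipschitz function `ℝ → ℝ`. -/
structure LipFun where
  toFun : ℝ → ℝ
  lipschitz : ∃ K : NNReal, LipschitzWith K toFun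

namespace LipFun

instance : CoeFun LipFun (fun _ => ℝ → ℝ) := ⟨LipFun.toFun⟩

/-- The identity function. -/
def ident : LipFun := ⟨id, 1, LipschitzWith.id⟩

/-- The Lipschitz constant `L_f`: the supremum of `|f y - f x| / |x - y|` over `x ≠ y`. -/
def lipConst (f : LipFun) : ℝ :=
  ⨆ p : {p : ℝ × ℝ // p.1 ≠ p.2}, |f p.1.2 - f p.1.1| / |p.1.1 - p.1.2|

end LipFun

/-- Backward iteration `f 0 ∘ f 1 ∘ ⋯ ∘ f (n - 1)`: the composition of the first `n` functions
of the sequence (the identity for `n = 0`). -/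
def backIter (f : ℕ → LipFun) : ℕ → ℝ → ℝ
  | 0 => id
  | n + 1 => backIter f n ∘ f n

/-- The infinite backward iteration: the limit of `(f 0 ∘ ⋯ ∘ f (n - 1)) z₀` as `n → ∞`
(meaningful when the limit exists). -/
def backLim (z₀ : ℝ) (f : ℕ → LipFun) : ℝ :=
  limUnder atTop (fun n => backIter f n z₀)

/-- The distribution of `Z_∞`, the limit of the backward iterations of i.i.d. functions with
distribution `ν`. -/
def limitLaw [MeasurableSpace LipFun] (ν : Measure LipFun) (z₀ : ℝ) : Measure ℝ :=
  (Measure.infinitePi (fun _ : ℕ => ν)).map (backLim z₀)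

/-- A random point set `Pts` is a Poisson process with intensity `Λ`: numbers of points in
measurable sets are random variables, those in sets of finite intensity are Poisson distributed,
and those in pairwise disjoint sets are independent. -/
structure IsPoissonProcess {Ω E : Type*} [MeasurableSpace Ω] [MeasurableSpace E]
    (Pts : Ω → Set E) (Λ : Measure E) (P : Measure Ω) : Prop where
  measurable_count : ∀ B : Set E, MeasurableSet B →
    Measurable (fun ω => (Pts ω ∩ B).encard)
  law_count : ∀ B : Set E, MeasurableSet B → Λ B ≠ ⊤ → ∀ n : ℕ,
    P {ω | (Pts ω ∩ B).encard = (n : ℕ∞)} = poissonMeasure (Λ B).toNNReal {n}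
  indep_count : ∀ (m : ℕ) (B : Fin m → Set E), (∀ i, MeasurableSet (B i)) →
    Pairwise (fun i j => Disjoint (B i) (B j)) →
    iIndepFun (fun i ω => (Pts ω ∩ B i).encard) P

/-- The intensity `Leb ⊗ Leb ⊗ ν` on `[0, ∞) × [0, ∞) × LipFun`. -/
def sieveIntensity [MeasurableSpace LipFun] (ν : Measure LipFun) :
    Measure (ℝ × ℝ × LipFun) :=
  ((volume : Measure ℝ).restrict (Ici 0)).prod
    (((volume : Measure ℝ).restrict (Ici 0)).prod ν)

/-- The points `(t, x, f)` of `S` with `x ∈ A`. -/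
def pointsOver (S : Set (ℝ × ℝ × LipFun)) (A : Set ℝ) : Set (ℝ × ℝ × LipFun) :=
  {q | q ∈ S ∧ q.2.1 ∈ A}

/-- `p` enumerates the points of `S` in increasing order of their first components. -/
def IsTimeEnum (S : Set (ℝ × ℝ × LipFun)) (p : ℕ → ℝ × ℝ × LipFun) : Prop :=
  StrictMono (fun k => (p k).1) ∧ range p = S

open Classical in
/-- The enumeration of the points of `S` in increasing order of their first components, when
there is one (it is then unique); an arbitrary sequence otherwise. -/
def timeEnum (S : Set (ℝ × ℝ × LipFun)) : ℕ → ℝ × ℝ × LipFun :=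
  if h : ∃ p, IsTimeEnum S p then h.choose else fun _ => (0, 0, LipFun.ident)

/-- The sieved backward iteration `ζ_t(A) = f_{1,A} ∘ ⋯ ∘ f_{N_A(t),A} (z₀)`, where
`N_A(t) = sup {k ≥ 1 : t_{k,A} ≤ t}` (and `sup ∅ = 0`). Entry `k` of the enumeration is the point
numbered `k + 1`. -/
def sievedIter (z₀ : ℝ) (S : Set (ℝ × ℝ × LipFun)) (A : Set ℝ) (t : ℝ) : ℝ :=
  backIter (fun k => (timeEnum (pointsOver S A) k).2.2)
    (sSup {n : ℕ | ∃ k : ℕ, n = k + 1 ∧ (timeEnum (pointsOver S A) k).1 ≤ t}) z₀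

/-- `ζ(x) = ζ([0, x])`, the limit of `ζ_t([0, x])` as `t → ∞`. -/
def zeta (z₀ : ℝ) (S : Set (ℝ × ℝ × LipFun)) (x : ℝ) : ℝ :=
  limUnder atTop (fun t : ℝ => sievedIter z₀ S (Icc 0 x) t)

/-- The recovery property. `𝓕` is the set of realisations of the random function with
distribution `ν`, and `K` is the support of `Z_∞`. Every `z ∈ K` is the infinite backward
iteration of exactly one sequence `g z` of realisations, and this sequence depends measurably
on `z`. Realisations map `K` to itself, so that `g z 0 ∘ g z 1 ∘ ⋯` is a decomposition
inside `K`. -/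
structure HasRecovery [MeasurableSpace LipFun] (ν : Measure LipFun) (z₀ : ℝ) (K : Set ℝ)
    (𝓕 : Set LipFun) (g : ℝ → ℕ → LipFun) : Prop where
  ae_mem : ∀ᵐ f ∂ν, f ∈ 𝓕
  mapsTo : ∀ f ∈ 𝓕, MapsTo f K K
  mem : ∀ z ∈ K, ∀ n, g z n ∈ 𝓕
  tendsto : ∀ z ∈ K, Tendsto (fun n => backIter (g z) n z₀) atTop (𝓝 z)
  unique : ∀ z ∈ K, ∀ g' : ℕ → LipFun, (∀ n, g' n ∈ 𝓕) →
    Tendsto (fun n => backIter g' n z₀) atTop (𝓝 z) → g' = g z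
  measurable : ∀ n, Measurable (fun z => g z n)

open Classical in
/-- Insert new functions into the sequence `g`: position `k` carries a label `u k` and a new
function `φ k`. If `u k ≤ a`, the position is taken by the next function of `g` not used before,
otherwise by `φ k`. -/
def insertSeq (a : ℝ) (g : ℕ → LipFun) (w : ℕ → unitInterval × LipFun) (k : ℕ) : LipFun :=
  if ((w k).1 : ℝ) ≤ a then
    g ((Finset.range k).filter (fun i => ((w i).1 : ℝ) ≤ a)).card
  else (w k).2

open Classical in
/-- Delete from the sequence `g` (replace by the identity) the functions with `u k > a`. -/
def deleteSeq (a : ℝ) (g : ℕ → LipFun) (u : ℕ → unitInterval) (k : ℕ) : LipFun :=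
  if (u k : ℝ) ≤ a then g k else LipFun.ident

/-- The law of the infinite iteration obtained from `g` by inserting, between consecutive
functions, independent geometric numbers (with parameter `1 - e^{-δ}`) of independent functions
with distribution `ν`: each position of the new sequence is, independently, an old one with
probability `e^{-δ}`. This is the distribution of `ζ(e^{t+δ})` given `ζ(e^t) = z` when
`g = g z`. -/
def insertLaw [MeasurableSpace LipFun] (ν : Measure LipFun) (z₀ : ℝ) (δ : ℝ)
    (g : ℕ → LipFun) : Measure ℝ :=
  (Measure.infinitePi (fun _ : ℕ => (volume : Measure unitInterval).prod ν)).map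
    (fun w => backLim z₀ (insertSeq (Real.exp (-δ)) g w))

/-- The law of the infinite iteration obtained from `g` by deleting each function independently
with probability `1 - e^{-δ}`. This is the distribution of `ζ(e^{t-δ})` given `ζ(e^t) = z` when
`g = g z`. -/
def deleteLaw (z₀ : ℝ) (δ : ℝ) (g : ℕ → LipFun) : Measure ℝ :=
  (Measure.infinitePi (fun _ : ℕ => (volume : Measure unitInterval))).map
    (fun u => backLim z₀ (deleteSeq (Real.exp (-δ)) g u))

/-- The family `q z`, `z ∈ K`, is a regular conditional distribution of `Y` given `X = z`. -/
def IsCondLawOn {Ω : Type*} [MeasurableSpace Ω] (P : Measure Ω) (Y X : Ω → ℝ) (K : Set ℝ)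
    (q : ℝ → Measure ℝ) : Prop :=
  (∀ᵐ ω ∂P, X ω ∈ K) ∧
    ∃ κ : Kernel ℝ ℝ, IsMarkovKernel κ ∧ (∀ z ∈ K, κ z = q z) ∧ HasCondDistrib Y X κ P

/-- `a` is the value at `z` of the generating operator applied to `h`, for the transition
laws `q δ z`: the limit of `δ⁻¹ (∫ h dq δ z - h z)` as `δ ↓ 0`. -/
def IsGeneratorValue (q : ℝ → ℝ → Measure ℝ) (h : ℝ → ℝ) (z a : ℝ) : Prop :=
  (∀ δ > 0, Integrable h (q δ z)) ∧
    Tendsto (fun δ : ℝ => δ⁻¹ * ((∫ y, h y ∂(q δ z)) - h z)) (𝓝[>] 0) (𝓝 a)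

/-- The `k`-th function inside `h` in the forward generator:
`g^{1↑k} ∘ f ∘ (g^{1↑k})⁻¹ (z)`, where the inverse is that of `g^{1↑k}` as a map on `K`. -/
def conjInsert (K : Set ℝ) (g : ℕ → LipFun) (k : ℕ) (f : LipFun) (z : ℝ) : ℝ :=
  backIter g k (f (Function.invFunOn (backIter g k) K z))

/-- The function inside `h` in the reverse generator:
`g^{1↑(k-1)} ∘ g_k⁻¹ ∘ (g^{1↑(k-1)})⁻¹ (z)`, inverses as maps on `K`, where `g 0, g 1, …` are
`g_1, g_2, …`, so that the entry `k` here belongs to `g_{k+1}`. -/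
def conjDelete (K : Set ℝ) (g : ℕ → LipFun) (k : ℕ) (z : ℝ) : ℝ :=
  backIter g k (Function.invFunOn (g k) K (Function.invFunOn (backIter g k) K z))

end

/-! Contraction and compactness make `backLim` converge for every sequence in `𝓕`, with a limit in
`K` that does not depend on the starting point. Sequences that agree in their first `n` entries have
limits within `c ^ n * diam K` of each other. By the recovery property `backLim` is a bijection from
the sequences in `𝓕` onto `K`, with inverse `g`. Conditioning on the limit is therefore conditioning
on the whole sequence. The inverse of the first `k` maps at `z` shifts the code of `z` by `k`, which
gives the injectivity and image statements (`HasRecovery.injOn`, `HasRecovery.invFunOn_backIter`).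

Transition laws. Fix a level `y`. The points of the Poisson process with second coordinate in `[0,
y]`, read in the order of their times, carry i.i.d. marks: a uniform label `x / y` and a function
with law `ν` (`IsMarkedRegion.exists_iid_marks`). The sieved limit at `y` uses all the functions,
and the one at `e^{-δ} y` only those with label at most `e^{-δ}` (`exists_iid_representation`). An
i.i.d. marked sequence can be built from an i.i.d. sequence `χ` by inserting independent functions
at the positions with large labels (`map_labelledInsert`). Then `χ` is the kept subsequence, it
equals `g` of its own limit, and the insertions are independent of it. This is the forward law. For
the reverse law the labels are independent of the complete sequence and delete from it.

The marks are shown to be i.i.d. using counts only. Time is cut into cells of length `1 / (d + 1)`,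
the probability that prescribed cells hold one point each with prescribed marks factorises, and as
`d → ∞` such patterns describe the first `n` points.

Generators. Looking at the first position of the inserted or deleted sequence gives a recursion in
the number `k` of old functions already applied. Unfolded, it writes the increment as a sum with
weights `e^{-kδ} (1 - e^{-δ})`. After division by `δ` the terms are dominated by a multiple of `c ^
k`, because changes behind the first `k` maps move the limit by at most `c ^ k * diam K` and `h`
satisfies a Lipschitz estimate at `z`. Dominated convergence gives the series
(`tendsto_of_geometric_recursion`). -/

/-! ### Lipschitz functions and finite backward iterations -/

lemma LipFun.continuous (f : LipFun) : Continuous f := by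
  obtain ⟨K, hK⟩ := f.lipschitz
  exact hK.continuous

lemma LipFun.abs_sub_le (f : LipFun) (x y : ℝ) : |f x - f y| ≤ f.lipConst * |x - y| := by
  obtain ⟨C, hC⟩ := f.lipschitz
  rcases eq_or_ne x y with rfl | hxy
  · simp
  have hpos : 0 < |y - x| := abs_pos.2 (sub_ne_zero.2 hxy.symm)
  -- A real supremum over an unbounded family is `0`, so the bound has to come from the Lipschitz
  -- property first.
  have hb : BddAbove (range fun p : {p : ℝ × ℝ // p.1 ≠ p.2} =>
      |f p.1.2 - f p.1.1| / |p.1.1 - p.1.2|) := by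
    refine ⟨C, ?_⟩
    rintro _ ⟨⟨⟨a, b⟩, hab⟩, rfl⟩
    have h : 0 < |a - b| := abs_pos.2 (sub_ne_zero.2 hab)
    have := hC.dist_le_mul a b
    simp only [Real.dist_eq] at this
    rw [div_le_iff₀ h, abs_sub_comm]
    exact this
  have := le_ciSup hb ⟨(y, x), hxy.symm⟩
  rw [div_le_iff₀ hpos] at this
  rw [abs_sub_comm x y]
  exact this

lemma LipFun.lipConst_nonneg (f : LipFun) : 0 ≤ f.lipConst := by
  have := f.abs_sub_le 1 0
  simp only [sub_zero, abs_one, mul_one] at this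
  exact (abs_nonneg _).trans this

lemma backIter_add (f : ℕ → LipFun) (m n : ℕ) (x : ℝ) :
    backIter f (m + n) x = backIter f m (backIter (fun k => f (m + k)) n x) := by
  induction n generalizing x with
  | zero => rfl
  | succ n ih => exact ih _

lemma backIter_succ_left (f : ℕ → LipFun) (n : ℕ) (x : ℝ) :
    backIter f (n + 1) x = f 0 (backIter (fun k => f (k + 1)) n x) := by
  rw [add_comm, backIter_add]
  simp only [add_comm 1]
  rfl

lemma backIter_congr {f g : ℕ → LipFun} {n : ℕ} (h : ∀ k < n, f k = g k) :
    backIter f n = backIter g n := by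
  induction n with
  | zero => rfl
  | succ n ih =>
    simp only [backIter]
    rw [ih fun k hk => h k (by omega), h n (by omega)]

lemma continuous_backIter (f : ℕ → LipFun) (n : ℕ) : Continuous (backIter f n) := by
  induction n with
  | zero => exact continuous_id
  | succ n ih => exact ih.comp (f n).continuous

/-! ### Infinite iterations under uniform contraction -/

/-- The functions in `𝓕` map the nonempty compact set `K` into itself and are Lipschitz with
constant `c < 1`. -/
structure ContractsOn (c : ℝ) (K : Set ℝ) (𝓕 : Set LipFun) : Prop where
  nonneg : 0 ≤ c
  lt_one : c < 1
  isCompact : IsCompact K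
  nonempty : K.Nonempty
  mapsTo : ∀ f ∈ 𝓕, MapsTo f K K
  abs_sub_le : ∀ f ∈ 𝓕, ∀ x y, |f x - f y| ≤ c * |x - y|

namespace ContractsOn

variable {c : ℝ} {K : Set ℝ} {𝓕 : Set LipFun}

lemma abs_sub_le_diam (H : ContractsOn c K 𝓕) {x y : ℝ} (hx : x ∈ K) (hy : y ∈ K) :
    |x - y| ≤ Metric.diam K :=
  Metric.dist_le_diam_of_mem H.isCompact.isBounded hx hy

lemma mapsTo_backIter (H : ContractsOn c K 𝓕) {f : ℕ → LipFun} (hf : ∀ n, f n ∈ 𝓕) (n : ℕ) :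
    MapsTo (backIter f n) K K := by
  induction n with
  | zero => exact mapsTo_id K
  | succ n ih => exact ih.comp (H.mapsTo _ (hf n))

lemma abs_backIter_sub_le (H : ContractsOn c K 𝓕) {f : ℕ → LipFun} (hf : ∀ n, f n ∈ 𝓕) (n : ℕ)
    (x y : ℝ) : |backIter f n x - backIter f n y| ≤ c ^ n * |x - y| := by
  induction n generalizing x y with
  | zero => simp [backIter]
  | succ n ih =>
    refine (ih (f n x) (f n y)).trans ?_
    rw [pow_succ, mul_assoc]
    exact mul_le_mul_of_nonneg_left (H.abs_sub_le _ (hf n) x y) (pow_nonneg H.nonneg n)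

lemma abs_backIter_sub_le_diam (H : ContractsOn c K 𝓕) {f : ℕ → LipFun} (hf : ∀ n, f n ∈ 𝓕)
    (n : ℕ) {x y : ℝ} (hx : x ∈ K) (hy : y ∈ K) :
    |backIter f n x - backIter f n y| ≤ c ^ n * Metric.diam K :=
  (H.abs_backIter_sub_le hf n x y).trans
    (mul_le_mul_of_nonneg_left (H.abs_sub_le_diam hx hy) (pow_nonneg H.nonneg n))

lemma tendsto_pow_mul (H : ContractsOn c K 𝓕) (d : ℝ) :
    Tendsto (fun n : ℕ => c ^ n * d) atTop (𝓝 0) := by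
  simpa using (tendsto_pow_atTop_nhds_zero_of_lt_one H.nonneg H.lt_one).mul_const d

/-- Consecutive iterates of a point of `K` differ only in the innermost argument, which `n`
contractions shrink geometrically. The same shrinking makes the starting point irrelevant, even
outside `K`. -/
lemma exists_tendsto (H : ContractsOn c K 𝓕) {f : ℕ → LipFun} (hf : ∀ n, f n ∈ 𝓕) :
    ∃ z ∈ K, ∀ x, Tendsto (fun n => backIter f n x) atTop (𝓝 z) := by
  obtain ⟨w, hw⟩ := H.nonempty
  have hmem : ∀ n, backIter f n w ∈ K := fun n => H.mapsTo_backIter hf n hw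
  have hcau : CauchySeq fun n => backIter f n w := by
    refine cauchySeq_of_le_geometric c (Metric.diam K) H.lt_one fun n => ?_
    rw [Real.dist_eq, mul_comm]
    exact H.abs_backIter_sub_le_diam hf n hw (H.mapsTo _ (hf n) hw)
  obtain ⟨z, hz⟩ := cauchySeq_tendsto_of_complete hcau
  refine ⟨z, H.isCompact.isClosed.mem_of_tendsto hz (Eventually.of_forall hmem), fun x => ?_⟩
  refine hz.congr_dist ?_
  refine squeeze_zero (fun _ => dist_nonneg) (fun n => ?_) (H.tendsto_pow_mul |w - x|)
  exact H.abs_backIter_sub_le hf n w x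

lemma tendsto_backLim (H : ContractsOn c K 𝓕) {f : ℕ → LipFun} (hf : ∀ n, f n ∈ 𝓕) (z₀ x : ℝ) :
    Tendsto (fun n => backIter f n x) atTop (𝓝 (backLim z₀ f)) := by
  obtain ⟨z, -, h⟩ := H.exists_tendsto hf
  rw [backLim, (h z₀).limUnder_eq]
  exact h x

lemma backLim_mem (H : ContractsOn c K 𝓕) {f : ℕ → LipFun} (hf : ∀ n, f n ∈ 𝓕) (z₀ : ℝ) :
    backLim z₀ f ∈ K := by
  obtain ⟨z, hz, h⟩ := H.exists_tendsto hf
  rwa [backLim, (h z₀).limUnder_eq]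

lemma backLim_eq_backIter (H : ContractsOn c K 𝓕) {f : ℕ → LipFun} (hf : ∀ n, f n ∈ 𝓕) (z₀ : ℝ)
    (m : ℕ) : backLim z₀ f = backIter f m (backLim z₀ fun k => f (m + k)) := by
  have h1 := (H.tendsto_backLim hf z₀ z₀).comp (tendsto_add_atTop_nat m)
  have h2 := ((continuous_backIter f m).tendsto _).comp
    (H.tendsto_backLim (f := fun k => f (m + k)) (fun n => hf _) z₀ z₀)
  refine tendsto_nhds_unique h1 (h2.congr fun n => ?_)
  simp only [Function.comp_apply]
  rw [add_comm n m, backIter_add]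

lemma backLim_eq_apply (H : ContractsOn c K 𝓕) {f : ℕ → LipFun} (hf : ∀ n, f n ∈ 𝓕) (z₀ : ℝ) :
    backLim z₀ f = f 0 (backLim z₀ fun k => f (k + 1)) := by
  rw [H.backLim_eq_backIter hf z₀ 1]
  simp only [add_comm 1]
  rfl

/-- Both limits are images of points of `K` under the same `n` contractions. This is the source of
every geometric bound on limits below. -/
lemma abs_backLim_sub_le (H : ContractsOn c K 𝓕) {f g : ℕ → LipFun} (hf : ∀ n, f n ∈ 𝓕)
    (hg : ∀ n, g n ∈ 𝓕) (z₀ : ℝ) {n : ℕ} (h : ∀ k < n, f k = g k) :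
    |backLim z₀ f - backLim z₀ g| ≤ c ^ n * Metric.diam K := by
  rw [H.backLim_eq_backIter hf z₀ n, H.backLim_eq_backIter hg z₀ n, backIter_congr h]
  exact H.abs_backIter_sub_le_diam hg n (H.backLim_mem (fun k => hf _) z₀)
    (H.backLim_mem (fun k => hg _) z₀)

end ContractsOn

/-! ### The recovery property as a coding of `K` by sequences -/

lemma HasRecovery.contractsOn [MeasurableSpace LipFun] {ν : Measure LipFun}
    [IsProbabilityMeasure ν] {z₀ c : ℝ} {K : Set ℝ} {𝓕 : Set LipFun} {g : ℝ → ℕ → LipFun}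
    (hrec : HasRecovery ν z₀ K 𝓕 g) (hcompact : IsCompact K) (hne : K.Nonempty) (hc1 : c < 1)
    (hc : ∀ f ∈ 𝓕, f.lipConst ≤ c) : ContractsOn c K 𝓕 where
  nonneg := by
    obtain ⟨f, hf⟩ := hrec.ae_mem.exists
    exact f.lipConst_nonneg.trans (hc f hf)
  lt_one := hc1
  isCompact := hcompact
  nonempty := hne
  mapsTo := hrec.mapsTo
  abs_sub_le f hf x y := (f.abs_sub_le x y).trans
    (mul_le_mul_of_nonneg_right (hc f hf) (abs_nonneg _))

namespace HasRecovery

variable [MeasurableSpace LipFun] {ν : Measure LipFun} {z₀ c : ℝ} {K : Set ℝ} {𝓕 : Set LipFun}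
  {g : ℝ → ℕ → LipFun}

lemma backLim_eq (hrec : HasRecovery ν z₀ K 𝓕 g) {z : ℝ} (hz : z ∈ K) : backLim z₀ (g z) = z :=
  (hrec.tendsto z hz).limUnder_eq

/-- The reason why conditioning on the limit amounts to conditioning on the sequence. -/
lemma eq_of_backLim (hrec : HasRecovery ν z₀ K 𝓕 g) (H : ContractsOn c K 𝓕) {f : ℕ → LipFun}
    (hf : ∀ n, f n ∈ 𝓕) : g (backLim z₀ f) = f :=
  (hrec.unique _ (H.backLim_mem hf z₀) f hf (H.tendsto_backLim hf z₀ z₀)).symm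

lemma backLim_injective (hrec : HasRecovery ν z₀ K 𝓕 g) (H : ContractsOn c K 𝓕)
    {f f' : ℕ → LipFun} (hf : ∀ n, f n ∈ 𝓕) (hf' : ∀ n, f' n ∈ 𝓕)
    (h : backLim z₀ f = backLim z₀ f') : f = f' := by
  rw [← hrec.eq_of_backLim H hf, h, hrec.eq_of_backLim H hf']

/-- The code of `x` with `f` put in front is a code of `f x`, so a coincidence of values would give
one point two codes. -/
lemma injOn (hrec : HasRecovery ν z₀ K 𝓕 g) (H : ContractsOn c K 𝓕) {f : LipFun}
    (hf : f ∈ 𝓕) : InjOn f K := by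
  intro x hx y hy hxy
  let s : ℝ → ℕ → LipFun := fun x n => n.casesOn f (g x)
  have hs : ∀ x ∈ K, ∀ n, s x n ∈ 𝓕 := by
    rintro x hx (_ | n)
    exacts [hf, hrec.mem x hx n]
  have hl : ∀ x ∈ K, backLim z₀ (s x) = f x := fun x hx => by
    rw [H.backLim_eq_apply (hs x hx)]
    change f (backLim z₀ (g x)) = f x
    rw [hrec.backLim_eq hx]
  have := hrec.backLim_injective H (hs x hx) (hs y hy) (by rw [hl x hx, hl y hy, hxy])
  have hg : g x = g y := funext fun n => congrFun this (n + 1)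
  rw [← hrec.backLim_eq hx, hg, hrec.backLim_eq hy]

lemma injOn_backIter (hrec : HasRecovery ν z₀ K 𝓕 g) (H : ContractsOn c K 𝓕) {f : ℕ → LipFun}
    (hf : ∀ n, f n ∈ 𝓕) (k : ℕ) : InjOn (backIter f k) K := by
  induction k with
  | zero => exact injOn_id K
  | succ k ih => exact ih.comp (hrec.injOn H (hf k)) (H.mapsTo _ (hf k))

/-- The inverse image of `z` under the first `k` functions of its sequence is the infinite
iteration of the remaining functions. -/
lemma invFunOn_backIter (hrec : HasRecovery ν z₀ K 𝓕 g) (H : ContractsOn c K 𝓕) {z : ℝ}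
    (hz : z ∈ K) (k : ℕ) :
    Function.invFunOn (backIter (g z) k) K z = backLim z₀ fun n => g z (k + n) := by
  have hm : backLim z₀ (fun n => g z (k + n)) ∈ K := H.backLim_mem (fun n => hrec.mem z hz _) z₀
  have := (hrec.injOn_backIter H (hrec.mem z hz) k).leftInvOn_invFunOn hm
  rwa [← H.backLim_eq_backIter (hrec.mem z hz), hrec.backLim_eq hz] at this

lemma mem_image_backIter (hrec : HasRecovery ν z₀ K 𝓕 g) (H : ContractsOn c K 𝓕) {z : ℝ}
    (hz : z ∈ K) (k : ℕ) : z ∈ backIter (g z) k '' K :=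
  ⟨_, H.backLim_mem (fun n => hrec.mem z hz (k + n)) z₀, by
    rw [← H.backLim_eq_backIter (hrec.mem z hz), hrec.backLim_eq hz]⟩

lemma backLim_shift (hrec : HasRecovery ν z₀ K 𝓕 g) (H : ContractsOn c K 𝓕) {z : ℝ}
    (hz : z ∈ K) (k : ℕ) : (backLim z₀ fun n => g z (k + n)) =
      g z k (backLim z₀ fun n => g z (k + 1 + n)) := by
  rw [H.backLim_eq_apply (fun n => hrec.mem z hz (k + n))]
  simp only [add_comm _ 1, ← add_assoc]
  rfl

lemma invFunOn_mem_image (hrec : HasRecovery ν z₀ K 𝓕 g) (H : ContractsOn c K 𝓕) {z : ℝ}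
    (hz : z ∈ K) (k : ℕ) : Function.invFunOn (backIter (g z) k) K z ∈ g z k '' K := by
  rw [hrec.invFunOn_backIter H hz, hrec.backLim_shift H hz]
  exact mem_image_of_mem _ (H.backLim_mem (fun n => hrec.mem z hz _) z₀)

/-- Removes the inverse: for `f ∈ 𝓕` the value is the limit of the code of `z` with `f` inserted
after `k` entries. -/
lemma conjInsert_eq (hrec : HasRecovery ν z₀ K 𝓕 g) (H : ContractsOn c K 𝓕) {z : ℝ}
    (hz : z ∈ K) (k : ℕ) (f : LipFun) :
    conjInsert K (g z) k f z = backIter (g z) k (f (backLim z₀ fun n => g z (k + n))) := by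
  rw [conjInsert, hrec.invFunOn_backIter H hz]

/-- Removes both inverses: the value is the limit of the code of `z` without its entry `k`. -/
lemma conjDelete_eq (hrec : HasRecovery ν z₀ K 𝓕 g) (H : ContractsOn c K 𝓕) {z : ℝ}
    (hz : z ∈ K) (k : ℕ) :
    conjDelete K (g z) k z = backIter (g z) k (backLim z₀ fun n => g z (k + 1 + n)) := by
  rw [conjDelete, hrec.invFunOn_backIter H hz, hrec.backLim_shift H hz,
    (hrec.injOn H (hrec.mem z hz k)).leftInvOn_invFunOn
      (H.backLim_mem (fun n => hrec.mem z hz _) z₀)]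

end HasRecovery

/-! ### Measurability of iterations, insertion and deletion -/

section Measurability

variable [MeasurableSpace LipFun]

/-- A Carathéodory function: continuous in the point and measurable in the function. -/
lemma LipFun.measurable_apply (hev : ∀ x : ℝ, Measurable (fun f : LipFun => f x)) :
    Measurable (fun p : LipFun × ℝ => p.1 p.2) :=
  (measurable_uncurry_of_continuous_of_measurable (u := fun (x : ℝ) (f : LipFun) => f x)
    (fun f => f.continuous) hev).comp measurable_swap

lemma measurable_backIter (hev : ∀ x : ℝ, Measurable (fun f : LipFun => f x)) (n : ℕ) :
    Measurable (fun p : (ℕ → LipFun) × ℝ => backIter p.1 n p.2) := by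
  induction n with
  | zero => exact measurable_snd
  | succ n ih =>
    refine ih.comp (measurable_fst.prodMk ((LipFun.measurable_apply hev).comp
      (((measurable_pi_apply n).comp measurable_fst).prodMk measurable_snd)))

lemma measurable_backLim (hev : ∀ x : ℝ, Measurable (fun f : LipFun => f x)) (z₀ : ℝ) :
    Measurable (backLim z₀) := by
  refine (StronglyMeasurable.limUnder (l := atTop)
    (f := fun (n : ℕ) (f : ℕ → LipFun) => backIter f n z₀) fun n => ?_).measurable
  exact ((measurable_backIter hev n).comp (measurable_id.prodMk measurable_const)).stronglyMeasurable

end Measurability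

lemma measurable_card_filter_range {X : Type*} [MeasurableSpace X] {p : X → Prop}
    [DecidablePred p] (hp : MeasurableSet {x | p x}) (k : ℕ) :
    Measurable (fun w : ℕ → X => ((Finset.range k).filter fun i => p (w i)).card) := by
  simp only [Finset.card_filter]
  exact Finset.measurable_sum _ fun i _ => Measurable.ite
    (hp.preimage (measurable_pi_apply i)) measurable_const measurable_const

lemma measurable_insertSeq [MeasurableSpace LipFun] (a : ℝ) :
    Measurable (fun p : (ℕ → LipFun) × (ℕ → unitInterval × LipFun) => insertSeq a p.1 p.2) := by
  classical
  have hle : MeasurableSet {x : unitInterval × LipFun | (x.1 : ℝ) ≤ a} :=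
    measurableSet_le (by fun_prop) measurable_const
  refine measurable_pi_lambda _ fun k => ?_
  simp only [insertSeq]
  refine Measurable.ite ?_ ?_ (by fun_prop)
  · exact hle.preimage (by fun_prop : Measurable
      fun p : (ℕ → LipFun) × (ℕ → unitInterval × LipFun) => p.2 k)
  · have h1 : Measurable (fun q : (ℕ → LipFun) × ℕ => q.1 q.2) :=
      measurable_from_prod_countable_left fun n => measurable_pi_apply n
    exact h1.comp (measurable_fst.prodMk
      ((measurable_card_filter_range (p := fun x : unitInterval × LipFun => (x.1 : ℝ) ≤ a)
        hle k).comp measurable_snd))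

lemma measurable_deleteSeq [MeasurableSpace LipFun] (a : ℝ) :
    Measurable (fun p : (ℕ → LipFun) × (ℕ → unitInterval) => deleteSeq a p.1 p.2) := by
  classical
  have hle : MeasurableSet {x : unitInterval | (x : ℝ) ≤ a} :=
    measurableSet_le (by fun_prop) measurable_const
  refine measurable_pi_lambda _ fun k => ?_
  simp only [deleteSeq]
  refine Measurable.ite ?_ (by fun_prop) measurable_const
  exact hle.preimage (by fun_prop : Measurable
      fun p : (ℕ → LipFun) × (ℕ → unitInterval) => p.2 k)

lemma support_limitLaw_nonempty [MeasurableSpace LipFun]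
    (hev : ∀ x : ℝ, Measurable (fun f : LipFun => f x)) (ν : Measure LipFun)
    [IsProbabilityMeasure ν] (z₀ : ℝ) : (limitLaw ν z₀).support.Nonempty := by
  have : IsProbabilityMeasure (limitLaw ν z₀) :=
    Measure.isProbabilityMeasure_map (measurable_backLim hev z₀).aemeasurable
  exact Measure.nonempty_support (IsProbabilityMeasure.ne_zero _)

/-! ### I.i.d. sequences -/

section InfiniteProduct

variable {X : Type*} [MeasurableSpace X] (μ : Measure X) [IsProbabilityMeasure μ]

lemma ae_forall_infinitePi {p : X → Prop} (h : ∀ᵐ x ∂μ, p x) :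
    ∀ᵐ w ∂Measure.infinitePi (fun _ : ℕ => μ), ∀ k, p (w k) :=
  ae_all_iff.2 fun k =>
    (measurePreserving_eval_infinitePi (fun _ : ℕ => μ) k).quasiMeasurePreserving.ae h

/-- A measure on sequences which has the right values on boxes is the product measure. -/
lemma eq_infinitePi_of_range {ρ : Measure (ℕ → X)}
    (h : ∀ (n : ℕ) (t : ℕ → Set X), (∀ i, MeasurableSet (t i)) →
      ρ {w | ∀ i < n, w i ∈ t i} = ∏ i ∈ Finset.range n, μ (t i)) :
    ρ = Measure.infinitePi (fun _ : ℕ => μ) := by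
  classical
  refine Measure.eq_infinitePi _ fun s t ht => ?_
  obtain ⟨n, hn⟩ := s.exists_nat_subset_range
  let t' : ℕ → Set X := fun i => if i ∈ s then t i else univ
  have hset : (s : Set ℕ).pi t = {w | ∀ i < n, w i ∈ t' i} := by
    ext w
    simp only [Set.mem_pi, Finset.mem_coe, mem_ofPred_eq, t']
    refine ⟨fun hw i _ => ?_, fun hw i hi => ?_⟩
    · split_ifs with hi
      exacts [hw i hi, mem_univ _]
    · have := hw i (Finset.mem_range.1 (hn hi))
      rwa [if_pos hi] at this
  rw [hset, h n t' fun i => ?_, ← Finset.prod_subset hn]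
  · exact Finset.prod_congr rfl fun i hi => by simp [t', hi]
  · intro i _ hi
    simp [t', hi]
  · simp only [t']
    split_ifs
    exacts [ht i, .univ]

lemma infinitePi_range (n : ℕ) {t : ℕ → Set X} (ht : ∀ i, MeasurableSet (t i)) :
    Measure.infinitePi (fun _ : ℕ => μ) {w | ∀ i < n, w i ∈ t i} =
      ∏ i ∈ Finset.range n, μ (t i) := by
  rw [← Measure.infinitePi_pi (fun _ : ℕ => μ) (fun i _ => ht i)]
  congr 1
  ext w
  simp

lemma measurableSet_range_box (n : ℕ) {t : ℕ → Set X} (ht : ∀ i, MeasurableSet (t i)) :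
    MeasurableSet {w : ℕ → X | ∀ i < n, w i ∈ t i} := by
  simp only [ofPred_forall]
  exact .iInter fun i => .iInter fun _ => (ht i).preimage (measurable_pi_apply i)

/-- Prepend an element to a sequence. -/
def consSeq {X : Type*} (x : X) (w : ℕ → X) : ℕ → X
  | 0 => x
  | n + 1 => w n

lemma measurable_consSeq : Measurable (fun p : X × (ℕ → X) => consSeq p.1 p.2) := by
  refine measurable_pi_lambda _ fun n => ?_
  cases n with
  | zero => exact measurable_fst
  | succ n => exact (measurable_pi_apply n).comp measurable_snd

lemma map_consSeq_infinitePi :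
    (μ.prod (Measure.infinitePi fun _ : ℕ => μ)).map (fun p => consSeq p.1 p.2) =
      Measure.infinitePi fun _ : ℕ => μ := by
  refine eq_infinitePi_of_range μ fun n t ht => ?_
  rw [Measure.map_apply measurable_consSeq (measurableSet_range_box n ht)]
  cases n with
  | zero => simp
  | succ n =>
    have : (fun p : X × (ℕ → X) => consSeq p.1 p.2) ⁻¹' {w | ∀ i < n + 1, w i ∈ t i} =
        t 0 ×ˢ {w | ∀ i < n, w i ∈ t (i + 1)} := by
      ext ⟨x, w⟩
      simp only [mem_preimage, mem_ofPred_eq, mem_prod]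
      refine ⟨fun h => ⟨h 0 (by omega), fun i hi => h (i + 1) (by omega)⟩, fun h i hi => ?_⟩
      cases i with
      | zero => exact h.1
      | succ i => exact h.2 i (by omega)
    rw [this, Measure.prod_prod, infinitePi_range μ n fun i => ht (i + 1),
      Finset.prod_range_succ', mul_comm]

/-- The event is contained in the box on the window `[n, n + m)`, of measure `μ A ^ m`, for every
`m`. -/
lemma infinitePi_forall_mem_Ici {A : Set X} (hA : MeasurableSet A) (hlt : μ A < 1) (n : ℕ) :
    Measure.infinitePi (fun _ : ℕ => μ) {w | ∀ k ≥ n, w k ∈ A} = 0 := by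
  refine le_antisymm (ge_of_tendsto' (ENNReal.tendsto_pow_atTop_nhds_zero_of_lt_one hlt)
    fun m => ?_) zero_le
  calc _ ≤ Measure.infinitePi (fun _ : ℕ => μ) ((Finset.Ico n (n + m) : Set ℕ).pi fun _ => A) :=
        by
        refine measure_mono fun w (hw : ∀ k ≥ n, w k ∈ A) k hk => hw k ?_
        exact (Finset.mem_Ico.1 hk).1
    _ = μ A ^ m := by
        rw [Measure.infinitePi_pi _ fun _ _ => hA]
        simp

lemma ae_infinite_infinitePi {A : Set X} (hA : MeasurableSet A) (hpos : μ A ≠ 0) :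
    ∀ᵐ w ∂Measure.infinitePi (fun _ : ℕ => μ), {k | w k ∈ A}.Infinite := by
  have hlt : μ Aᶜ < 1 := by
    rw [prob_compl_eq_one_sub hA]
    exact ENNReal.sub_lt_self ENNReal.one_ne_top one_ne_zero hpos
  have : ∀ᵐ w ∂Measure.infinitePi (fun _ : ℕ => μ), ∀ n, ¬ ∀ k ≥ n, w k ∈ Aᶜ :=
    ae_all_iff.2 fun n => by
      rw [ae_iff]
      simpa using infinitePi_forall_mem_Ici μ hA.compl hlt n
  filter_upwards [this] with w hw
  refine Set.infinite_of_forall_exists_gt fun n => ?_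
  have := hw (n + 1)
  push Not at this
  obtain ⟨k, hk, hkA⟩ := this
  exact ⟨k, by simpa using hkA, hk⟩

end InfiniteProduct

/-! ### Pathwise structure of insertion and deletion -/

lemma volume_unitInterval_le {a : ℝ} (h0 : 0 ≤ a) (h1 : a ≤ 1) :
    (volume : Measure unitInterval) {u | (u : ℝ) ≤ a} = ENNReal.ofReal a := by
  have : {u : unitInterval | (u : ℝ) ≤ a} = Iic ⟨a, h0, h1⟩ := rfl
  rw [this, unitInterval.volume_Iic]

lemma integral_unitInterval_ite {a : ℝ} (h0 : 0 ≤ a) (h1 : a ≤ 1) (x y : ℝ) :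
    ∫ u : unitInterval, (if (u : ℝ) ≤ a then x else y) = a * x + (1 - a) * y := by
  classical
  have hm : MeasurableSet {u : unitInterval | (u : ℝ) ≤ a} :=
    measurableSet_le (by fun_prop) measurable_const
  have h : (fun u : unitInterval => if (u : ℝ) ≤ a then x else y) =
      fun u => {u : unitInterval | (u : ℝ) ≤ a}.indicator (fun _ => x - y) u + y := by
    ext u
    simp only [indicator, mem_ofPred_eq]
    split_ifs <;> ring
  rw [h, integral_add ((integrable_const _).indicator hm) (integrable_const _),
    integral_indicator_const _ hm, Measure.real, volume_unitInterval_le h0 h1]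
  simp [ENNReal.toReal_ofReal h0]
  ring

open Classical in
lemma insertSeq_eq_count (a : ℝ) (g : ℕ → LipFun) (w : ℕ → unitInterval × LipFun) (k : ℕ) :
    insertSeq a g w k = if ((w k).1 : ℝ) ≤ a then
      g (Nat.count (fun i => ((w i).1 : ℝ) ≤ a) k) else (w k).2 := by
  rw [insertSeq, Nat.count_eq_card_filter_range]

lemma insertSeq_mem {𝓕 : Set LipFun} {a : ℝ} {g : ℕ → LipFun} {w : ℕ → unitInterval × LipFun}
    (hg : ∀ n, g n ∈ 𝓕) (hw : ∀ n, (w n).2 ∈ 𝓕) (k : ℕ) : insertSeq a g w k ∈ 𝓕 := by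
  rw [insertSeq]
  split_ifs
  exacts [hg _, hw _]

open Classical in
lemma count_consSeq (a : ℝ) (x : unitInterval × LipFun) (w : ℕ → unitInterval × LipFun) (k : ℕ) :
    Nat.count (fun i => ((consSeq x w i).1 : ℝ) ≤ a) (k + 1) =
      Nat.count (fun i => ((w i).1 : ℝ) ≤ a) k + if (x.1 : ℝ) ≤ a then 1 else 0 := by
  rw [Nat.count_succ']
  rfl

/-- The old sequence is shifted only when its first entry is used; together with
`insertSeq_cons_of_lt` this is the pathwise form of the recursion for the insertion laws. -/
lemma insertSeq_cons_of_le {a : ℝ} (g : ℕ → LipFun) {x : unitInterval × LipFun}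
    (w : ℕ → unitInterval × LipFun) (hx : (x.1 : ℝ) ≤ a) :
    insertSeq a g (consSeq x w) = consSeq (g 0) (insertSeq a (fun n => g (n + 1)) w) := by
  funext k
  cases k with
  | zero =>
    rw [insertSeq_eq_count]
    exact (if_pos hx).trans (by rw [Nat.count_zero]; rfl)
  | succ k =>
    rw [insertSeq_eq_count, count_consSeq, if_pos hx]
    simp only [consSeq, insertSeq_eq_count]
    congr

lemma insertSeq_cons_of_lt {a : ℝ} (g : ℕ → LipFun) {x : unitInterval × LipFun}
    (w : ℕ → unitInterval × LipFun) (hx : a < x.1) :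
    insertSeq a g (consSeq x w) = consSeq x.2 (insertSeq a g w) := by
  funext k
  cases k with
  | zero =>
    rw [insertSeq_eq_count]
    exact if_neg hx.not_ge
  | succ k =>
    rw [insertSeq_eq_count, count_consSeq, if_neg hx.not_ge, add_zero]
    simp only [consSeq, insertSeq_eq_count]
    congr

lemma insertSeq_eq_of_forall_le {a : ℝ} (g : ℕ → LipFun) {w : ℕ → unitInterval × LipFun} {n : ℕ}
    (hw : ∀ k < n, ((w k).1 : ℝ) ≤ a) {k : ℕ} (hk : k < n) : insertSeq a g w k = g k := by
  rw [insertSeq, if_pos (hw k hk), Finset.filter_true_of_mem, Finset.card_range]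
  exact fun i hi => hw i ((Finset.mem_range.1 hi).trans hk)

lemma deleteSeq_cons (a : ℝ) (g : ℕ → LipFun) (x : unitInterval) (u : ℕ → unitInterval) :
    deleteSeq a g (consSeq x u) =
      consSeq (if (x : ℝ) ≤ a then g 0 else LipFun.ident) (deleteSeq a (fun n => g (n + 1)) u) := by
  funext k
  cases k <;> simp only [deleteSeq, consSeq] <;> congr

/-- If the backward iterations of `s` converge, prepending `f` applies `f` to the limit. -/
lemma backLim_consSeq {z₀ z : ℝ} (f : LipFun) {s : ℕ → LipFun}
    (h : Tendsto (fun n => backIter s n z₀) atTop (𝓝 z)) : backLim z₀ (consSeq f s) = f z := by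
  refine Tendsto.limUnder_eq ((tendsto_add_atTop_iff_nat 1).1 ?_)
  refine ((f.continuous.tendsto z).comp h).congr fun n => ?_
  rw [backIter_succ_left]
  rfl

open Classical in
/-- Deleting functions leaves the backward iteration of the subsequence of the remaining ones. -/
lemma backIter_deleteSeq (a : ℝ) (g : ℕ → LipFun) (u : ℕ → unitInterval) (n : ℕ) :
    backIter (deleteSeq a g u) n =
      backIter (fun j => g (Nat.nth (fun k => (u k : ℝ) ≤ a) j))
        (Nat.count (fun k => (u k : ℝ) ≤ a) n) := by
  induction n with
  | zero => simp [backIter]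
  | succ n ih =>
    rw [Nat.count_succ]
    simp only [backIter]
    rw [ih, deleteSeq]
    split_ifs with h
    · simp only [backIter]
      rw [Nat.nth_count h]
    · rfl

lemma tendsto_count_atTop {p : ℕ → Prop} [DecidablePred p] (hp : {k | p k}.Infinite) :
    Tendsto (Nat.count p) atTop atTop := by
  refine tendsto_atTop_atTop_of_monotone (Nat.count_monotone p) fun b => ⟨Nat.nth p b, ?_⟩
  rw [Nat.count_nth_of_infinite hp]

namespace ContractsOn

variable {c : ℝ} {K : Set ℝ} {𝓕 : Set LipFun}

/-- The identities standing for deleted functions need not lie in `𝓕`, so the contraction is applied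
to the subsequence of kept functions; infinitely many of them are needed. -/
lemma tendsto_deleteSeq (H : ContractsOn c K 𝓕) (z₀ : ℝ) {a : ℝ} {g : ℕ → LipFun}
    (hg : ∀ n, g n ∈ 𝓕) {u : ℕ → unitInterval} (hu : {k | (u k : ℝ) ≤ a}.Infinite) :
    Tendsto (fun n => backIter (deleteSeq a g u) n z₀) atTop
      (𝓝 (backLim z₀ fun j => g (Nat.nth (fun k => (u k : ℝ) ≤ a) j))) := by
  classical
  simp only [backIter_deleteSeq]
  exact (H.tendsto_backLim (f := fun j => g (Nat.nth (fun k => (u k : ℝ) ≤ a) j))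
    (fun n => hg _) z₀ z₀).comp (tendsto_count_atTop hu)

lemma backLim_deleteSeq (H : ContractsOn c K 𝓕) (z₀ : ℝ) {a : ℝ} {g : ℕ → LipFun}
    (hg : ∀ n, g n ∈ 𝓕) {u : ℕ → unitInterval} (hu : {k | (u k : ℝ) ≤ a}.Infinite) :
    backLim z₀ (deleteSeq a g u) =
      backLim z₀ fun j => g (Nat.nth (fun k => (u k : ℝ) ≤ a) j) :=
  (H.tendsto_deleteSeq z₀ hg hu).limUnder_eq

end ContractsOn

/-! ### Differentiation of a geometric recursion -/

/-- Expansion of a sequence with a geometric recursion, and its derivative at `0`. -/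
lemma tendsto_of_geometric_recursion {r s : ℝ → ℕ → ℝ} {S : ℕ → ℝ} {v C c : ℝ} (hc0 : 0 ≤ c)
    (hc1 : c < 1)
    (hrec : ∀ δ > 0, ∀ k, r δ k = Real.exp (-δ) * r δ (k + 1) + (1 - Real.exp (-δ)) * s δ k)
    (hr : ∀ δ > 0, ∀ k, |r δ k - v| ≤ C * c ^ k) (hs : ∀ δ > 0, ∀ k, |s δ k - v| ≤ C * c ^ k)
    (hlim : ∀ k, Tendsto (fun δ => s δ k) (𝓝[>] 0) (𝓝 (S k))) :
    Summable (fun k => S k - v) ∧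
      Tendsto (fun δ => δ⁻¹ * (r δ 0 - v)) (𝓝[>] 0) (𝓝 (∑' k, (S k - v))) := by
  have hsum : Summable fun k : ℕ => C * c ^ k := (summable_geometric_of_lt_one hc0 hc1).mul_left C
  have hpos : ∀ᶠ δ : ℝ in 𝓝[>] 0, 0 < δ := eventually_mem_nhdsWithin
  have hS : ∀ k, |S k - v| ≤ C * c ^ k := fun k =>
    le_of_tendsto (((hlim k).sub_const v).abs) (hpos.mono fun δ hδ => hs δ hδ k)
  refine ⟨Summable.of_norm_bounded hsum hS, ?_⟩
  -- The recursion also holds for the differences from `v`, since its weights add up to `1`; this is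
  -- its `n`-fold unfolding.
  have hpart : ∀ δ > 0, ∀ n, r δ 0 - v = ∑ k ∈ Finset.range n,
      Real.exp (-δ) ^ k * (1 - Real.exp (-δ)) * (s δ k - v) +
        Real.exp (-δ) ^ n * (r δ n - v) := by
    intro δ hδ n
    induction n with
    | zero => simp
    | succ n ih =>
      rw [ih, Finset.sum_range_succ, hrec δ hδ n]
      ring
  have hle : ∀ δ > (0 : ℝ), δ⁻¹ * (1 - Real.exp (-δ)) ≤ 1 := fun δ hδ => by
    rw [inv_mul_le_iff₀ hδ]
    linarith [Real.add_one_le_exp (-δ)]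
  have hge : ∀ δ > (0 : ℝ), 0 ≤ δ⁻¹ * (1 - Real.exp (-δ)) := fun δ hδ =>
    mul_nonneg (inv_nonneg.2 hδ.le) (by
      have := Real.exp_le_one_iff.2 (neg_nonpos.2 hδ.le); linarith)
  have hterm : ∀ δ > 0, ∀ k,
      |Real.exp (-δ) ^ k * (δ⁻¹ * (1 - Real.exp (-δ))) * (s δ k - v)| ≤ C * c ^ k := by
    intro δ hδ k
    have h1 : Real.exp (-δ) ^ k ≤ 1 :=
      pow_le_one₀ (Real.exp_pos _).le (Real.exp_le_one_iff.2 (neg_nonpos.2 hδ.le))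
    have h2 : 0 ≤ Real.exp (-δ) ^ k := pow_nonneg (Real.exp_pos _).le k
    rw [abs_mul, abs_of_nonneg (mul_nonneg h2 (hge δ hδ))]
    refine (mul_le_of_le_one_left (abs_nonneg _) ?_).trans (hs δ hδ k)
    exact mul_le_one₀ h1 (hge δ hδ) (hle δ hδ)
  have hexp : ∀ δ > 0, δ⁻¹ * (r δ 0 - v) =
      ∑' k, Real.exp (-δ) ^ k * (δ⁻¹ * (1 - Real.exp (-δ))) * (s δ k - v) := by
    intro δ hδ
    have h1 := (Summable.of_norm_bounded (f := fun k => Real.exp (-δ) ^ k *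
      (δ⁻¹ * (1 - Real.exp (-δ))) * (s δ k - v)) hsum (hterm δ hδ)).hasSum.tendsto_sum_nat
    refine tendsto_nhds_unique ?_ h1
    have h2 : Tendsto (fun n => δ⁻¹ * (r δ 0 - v) -
        δ⁻¹ * (Real.exp (-δ) ^ n * (r δ n - v))) atTop (𝓝 (δ⁻¹ * (r δ 0 - v) - δ⁻¹ * 0)) := by
      refine (Tendsto.const_mul _ ?_).const_sub _
      -- The remainder after `n` unfoldings vanishes by the bound on `r δ n - v` alone.
      refine squeeze_zero_norm (fun n => ?_) (hsum.tendsto_atTop_zero)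
      rw [Real.norm_eq_abs, abs_mul, abs_of_nonneg (pow_nonneg (Real.exp_pos _).le n)]
      exact (mul_le_of_le_one_left (abs_nonneg _) (pow_le_one₀ (Real.exp_pos _).le
        (Real.exp_le_one_iff.2 (neg_nonpos.2 hδ.le)))).trans (hr δ hδ n)
    rw [mul_zero, sub_zero] at h2
    refine h2.congr fun n => ?_
    conv_lhs => enter [1]; rw [hpart δ hδ n]
    rw [mul_add, add_sub_cancel_right, Finset.mul_sum]
    exact Finset.sum_congr rfl fun k _ => by ring
  have hmain : Tendsto (fun δ => ∑' k, Real.exp (-δ) ^ k * (δ⁻¹ * (1 - Real.exp (-δ))) *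
      (s δ k - v)) (𝓝[>] 0) (𝓝 (∑' k, (S k - v))) := by
    refine tendsto_tsum_of_dominated_convergence hsum (fun k => ?_)
      (hpos.mono fun δ hδ k => hterm δ hδ k)
    have he : Tendsto (fun δ : ℝ => Real.exp (-δ)) (𝓝[>] 0) (𝓝 1) := by
      have : Continuous fun δ : ℝ => Real.exp (-δ) := by fun_prop
      simpa using (this.tendsto 0).mono_left nhdsWithin_le_nhds
    have hd : Tendsto (fun δ : ℝ => δ⁻¹ * (1 - Real.exp (-δ))) (𝓝[>] 0) (𝓝 1) := by
      have h : HasDerivAt (fun δ : ℝ => 1 - Real.exp (-δ)) 1 0 := by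
        have := ((hasDerivAt_neg (0 : ℝ)).exp).const_sub 1
        simpa using this
      have := h.tendsto_slope_zero_right
      simpa using this
    simpa using ((he.pow k).mul hd).mul ((hlim k).sub_const v)
  exact hmain.congr' (hpos.mono fun δ hδ => (hexp δ hδ).symm)

lemma ae_infinite_le {a : ℝ} (ha : 0 < a) :
    ∀ᵐ u ∂Measure.infinitePi (fun _ : ℕ => (volume : Measure unitInterval)),
      {k | (u k : ℝ) ≤ a}.Infinite := by
  -- Truncation at `1` makes the level a point of the unit interval, so that the volume formula
  -- applies.
  refine (ae_infinite_infinitePi volume (A := {u : unitInterval | (u : ℝ) ≤ min a 1})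
    (measurableSet_le (by fun_prop) measurable_const) ?_).mono fun u hu =>
      hu.mono fun k (hk : (u k : ℝ) ≤ min a 1) => hk.trans (min_le_left _ _)
  rw [volume_unitInterval_le (le_min ha.le zero_le_one) (min_le_right _ _)]
  simp [ha]

lemma integrable_of_measurable_of_abs_le {X : Type*} [MeasurableSpace X] {μ : Measure X}
    [IsFiniteMeasure μ] {F : X → ℝ} (hF : Measurable F) {M : ℝ} (hM : ∀ x, |F x| ≤ M) :
    Integrable F μ :=
  Integrable.of_bound hF.aestronglyMeasurable M (ae_of_all _ hM)

lemma abs_integral_sub_le {X : Type*} [MeasurableSpace X] {μ : Measure X} [IsProbabilityMeasure μ]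
    {F : X → ℝ} (hF : Integrable F μ) {v B : ℝ} (h : ∀ᵐ x ∂μ, |F x - v| ≤ B) :
    |(∫ x, F x ∂μ) - v| ≤ B := by
  have : (∫ x, F x ∂μ) - v = ∫ x, (F x - v) ∂μ := by
    rw [integral_sub hF (integrable_const _)]
    simp
  rw [this, ← Real.norm_eq_abs]
  simpa using norm_integral_le_of_norm_le_const (f := fun x => F x - v) h

lemma abs_integral_le {X : Type*} [MeasurableSpace X] {μ : Measure X} [IsProbabilityMeasure μ]
    {F : X → ℝ} {M : ℝ} (h : ∀ x, |F x| ≤ M) : |∫ x, F x ∂μ| ≤ M := by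
  rw [← Real.norm_eq_abs]
  simpa using norm_integral_le_of_norm_le_const (f := F) (μ := μ) (ae_of_all _ h)

/-- Integrals over i.i.d. sequences, by conditioning on the first element. -/
lemma integral_infinitePi_consSeq {X : Type*} [MeasurableSpace X] (μ : Measure X)
    [IsProbabilityMeasure μ] {Ψ : (ℕ → X) → ℝ} (hΨ : Measurable Ψ) {M : ℝ}
    (hM : ∀ w, |Ψ w| ≤ M) :
    ∫ w, Ψ w ∂Measure.infinitePi (fun _ : ℕ => μ) =
      ∫ x, ∫ w, Ψ (consSeq x w) ∂Measure.infinitePi (fun _ : ℕ => μ) ∂μ := by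
  conv_lhs => rw [← map_consSeq_infinitePi μ]
  rw [integral_map measurable_consSeq.aemeasurable hΨ.aestronglyMeasurable]
  exact integral_prod (fun p : X × (ℕ → X) => Ψ (consSeq p.1 p.2))
    (integrable_of_measurable_of_abs_le (hΨ.comp measurable_consSeq) fun p => hM _)

lemma eventually_forall_le_exp {n : ℕ} {u : ℕ → ℝ} (hu : ∀ k, u k < 1) :
    ∀ᶠ δ in 𝓝[>] (0 : ℝ), ∀ k < n, u k ≤ Real.exp (-δ) := by
  have he : Tendsto (fun δ : ℝ => Real.exp (-δ)) (𝓝[>] 0) (𝓝 1) := by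
    have : Continuous fun δ : ℝ => Real.exp (-δ) := by fun_prop
    simpa using (this.tendsto 0).mono_left nhdsWithin_le_nhds
  exact (eventually_all_finite (finite_lt_nat n)).2 fun k _ =>
    (he.eventually (eventually_gt_nhds (hu k))).mono fun _ h => h.le

lemma ContractsOn.tendsto_of_eventually_eq {c : ℝ} {K : Set ℝ} {𝓕 : Set LipFun}
    (H : ContractsOn c K 𝓕) {z₀ : ℝ} {g : ℕ → LipFun}
    (hg : ∀ n, g n ∈ 𝓕) {s : ℝ → ℕ → LipFun} {l : Filter ℝ}
    (hs : ∀ᶠ δ in l, ∀ n, s δ n ∈ 𝓕)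
    (h : ∀ n, ∀ᶠ δ in l, ∀ k < n, s δ k = g k) :
    Tendsto (fun δ => backLim z₀ (s δ)) l (𝓝 (backLim z₀ g)) := by
  rw [Metric.tendsto_nhds]
  intro ε hε
  obtain ⟨n, hn⟩ := ((H.tendsto_pow_mul (Metric.diam K)).eventually (eventually_lt_nhds hε)).exists
  filter_upwards [hs, h n] with δ h1 h2
  exact (H.abs_backLim_sub_le h1 hg z₀ h2).trans_lt hn

lemma ae_forall_lt_one :
    ∀ᵐ u ∂Measure.infinitePi (fun _ : ℕ => (volume : Measure unitInterval)),
      ∀ k, (u k : ℝ) < 1 := by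
  refine ae_forall_infinitePi _ (p := fun u : unitInterval => (u : ℝ) < 1) ?_
  have : ∀ᵐ u : unitInterval, u ≠ 1 := by simp [ae_iff]
  filter_upwards [this] with u hu
  exact lt_of_le_of_ne u.2.2 fun h => hu (Subtype.ext h)

/-! ### Insertion and deletion laws: support, recursion, limit as `δ ↓ 0` -/

section Laws

variable [MeasurableSpace LipFun] {c : ℝ}
  {K : Set ℝ} {𝓕 : Set LipFun}

lemma measurable_backLim_insertSeq (hev : ∀ x : ℝ, Measurable (fun f : LipFun => f x)) (z₀ a : ℝ)
    (g : ℕ → LipFun) : Measurable (fun w => backLim z₀ (insertSeq a g w)) :=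
  (measurable_backLim hev z₀).comp ((measurable_insertSeq a).comp
    (measurable_const.prodMk measurable_id))

lemma measurable_backLim_deleteSeq (hev : ∀ x : ℝ, Measurable (fun f : LipFun => f x)) (z₀ a : ℝ)
    (g : ℕ → LipFun) : Measurable (fun u => backLim z₀ (deleteSeq a g u)) :=
  (measurable_backLim hev z₀).comp ((measurable_deleteSeq a).comp
    (measurable_const.prodMk measurable_id))

lemma isProbabilityMeasure_insertLaw {ν : Measure LipFun} [IsProbabilityMeasure ν]
    (hev : ∀ x : ℝ, Measurable (fun f : LipFun => f x))
    (z₀ δ : ℝ) (g : ℕ → LipFun) : IsProbabilityMeasure (insertLaw ν z₀ δ g) :=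
  Measure.isProbabilityMeasure_map (measurable_backLim_insertSeq hev z₀ _ g).aemeasurable

lemma isProbabilityMeasure_deleteLaw (hev : ∀ x : ℝ, Measurable (fun f : LipFun => f x))
    (z₀ δ : ℝ) (g : ℕ → LipFun) : IsProbabilityMeasure (deleteLaw z₀ δ g) :=
  Measure.isProbabilityMeasure_map (measurable_backLim_deleteSeq hev z₀ _ g).aemeasurable

lemma integral_insertLaw {ν : Measure LipFun} (hev : ∀ x : ℝ, Measurable (fun f : LipFun => f x)) {Φ : ℝ → ℝ}
    (hΦ : Measurable Φ) (z₀ δ : ℝ) (g : ℕ → LipFun) :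
    ∫ y, Φ y ∂(insertLaw ν z₀ δ g) = ∫ w, Φ (backLim z₀ (insertSeq (Real.exp (-δ)) g w))
      ∂Measure.infinitePi (fun _ : ℕ => (volume : Measure unitInterval).prod ν) :=
  integral_map (measurable_backLim_insertSeq hev z₀ _ g).aemeasurable hΦ.aestronglyMeasurable

lemma integral_deleteLaw (hev : ∀ x : ℝ, Measurable (fun f : LipFun => f x)) {Φ : ℝ → ℝ}
    (hΦ : Measurable Φ) (z₀ δ : ℝ) (g : ℕ → LipFun) :
    ∫ y, Φ y ∂(deleteLaw z₀ δ g) = ∫ u, Φ (backLim z₀ (deleteSeq (Real.exp (-δ)) g u))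
      ∂Measure.infinitePi (fun _ : ℕ => (volume : Measure unitInterval)) :=
  integral_map (measurable_backLim_deleteSeq hev z₀ _ g).aemeasurable hΦ.aestronglyMeasurable

lemma ae_forall_snd_mem {ν : Measure LipFun} [IsProbabilityMeasure ν]
    (hν : ∀ᵐ f ∂ν, f ∈ 𝓕) :
    ∀ᵐ w ∂Measure.infinitePi (fun _ : ℕ => (volume : Measure unitInterval).prod ν),
      ∀ k, (w k).2 ∈ 𝓕 :=
  ae_forall_infinitePi _ (Measure.quasiMeasurePreserving_snd.ae hν)

lemma ae_mem_insertLaw {ν : Measure LipFun} [IsProbabilityMeasure ν]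
    (hev : ∀ x : ℝ, Measurable (fun f : LipFun => f x))
    (H : ContractsOn c K 𝓕) (hν : ∀ᵐ f ∂ν, f ∈ 𝓕) (z₀ δ : ℝ) {g : ℕ → LipFun}
    (hg : ∀ n, g n ∈ 𝓕) : ∀ᵐ y ∂insertLaw ν z₀ δ g, y ∈ K := by
  rw [insertLaw, ae_map_iff (p := (· ∈ K)) (measurable_backLim_insertSeq hev z₀ _ g).aemeasurable
    H.isCompact.measurableSet]
  filter_upwards [ae_forall_snd_mem hν] with w hw
  exact H.backLim_mem (insertSeq_mem hg hw) z₀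

lemma ae_mem_deleteLaw (hev : ∀ x : ℝ, Measurable (fun f : LipFun => f x))
    (H : ContractsOn c K 𝓕) (z₀ δ : ℝ) {g : ℕ → LipFun}
    (hg : ∀ n, g n ∈ 𝓕) : ∀ᵐ y ∂deleteLaw z₀ δ g, y ∈ K := by
  rw [deleteLaw, ae_map_iff (p := (· ∈ K)) (measurable_backLim_deleteSeq hev z₀ _ g).aemeasurable
    H.isCompact.measurableSet]
  filter_upwards [ae_infinite_le (Real.exp_pos (-δ))] with u hu
  rw [H.backLim_deleteSeq z₀ hg hu]
  exact H.backLim_mem (fun j => hg _) z₀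

lemma measurable_comp_uncurry (hev : ∀ x : ℝ, Measurable (fun f : LipFun => f x)) {Φ : ℝ → ℝ}
    (hΦ : Measurable Φ) : Measurable (fun p : LipFun × ℝ => Φ (p.1 p.2)) :=
  hΦ.comp (LipFun.measurable_apply hev)

/-- The recursion of the insertion laws: the first function is the old one with probability
`e^{-δ}` and a new one otherwise. -/
lemma integral_insertLaw_recursion {ν : Measure LipFun} [IsProbabilityMeasure ν]
    (hev : ∀ x : ℝ, Measurable (fun f : LipFun => f x))
    (H : ContractsOn c K 𝓕) (hν : ∀ᵐ f ∂ν, f ∈ 𝓕) (z₀ : ℝ) {δ : ℝ} (hδ : 0 < δ)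
    {g : ℕ → LipFun} (hg : ∀ n, g n ∈ 𝓕) {Φ : ℝ → ℝ} (hΦ : Measurable Φ) {M : ℝ}
    (hM : ∀ x, |Φ x| ≤ M) :
    ∫ y, Φ y ∂(insertLaw ν z₀ δ g) =
      Real.exp (-δ) * ∫ y, Φ (g 0 y) ∂(insertLaw ν z₀ δ fun n => g (n + 1)) +
        (1 - Real.exp (-δ)) * ∫ f, ∫ y, Φ (f y) ∂(insertLaw ν z₀ δ g) ∂ν := by
  have ha0 := (Real.exp_pos (-δ)).le
  have ha1 := Real.exp_le_one_iff.2 (neg_nonpos.2 hδ.le)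
  have hgf : ∀ f : LipFun, Measurable fun y => Φ (f y) := fun f => hΦ.comp f.continuous.measurable
  have := isProbabilityMeasure_insertLaw (ν := ν) hev z₀ δ g
  rw [integral_insertLaw hev hΦ, integral_infinitePi_consSeq _
    (Ψ := fun w => Φ (backLim z₀ (insertSeq (Real.exp (-δ)) g w)))
    (hΦ.comp (measurable_backLim_insertSeq hev z₀ _ g)) (fun w => hM _)]
  set A := ∫ y, Φ (g 0 y) ∂(insertLaw ν z₀ δ fun n => g (n + 1)) with hA
  set B : LipFun → ℝ := fun f => ∫ y, Φ (f y) ∂(insertLaw ν z₀ δ g) with hB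
  have hBm : Measurable B := ((measurable_comp_uncurry hev hΦ).stronglyMeasurable
    |>.integral_prod_right (ν := insertLaw ν z₀ δ g)).measurable
  have hBM : ∀ f, |B f| ≤ M := fun f => abs_integral_le fun y => hM (f y)
  have hle : MeasurableSet {x : unitInterval × LipFun | (x.1 : ℝ) ≤ Real.exp (-δ)} :=
    measurableSet_le (by fun_prop) measurable_const
  have hAM : |A| ≤ M := by
    have := isProbabilityMeasure_insertLaw (ν := ν) hev z₀ δ fun n => g (n + 1)
    exact abs_integral_le fun y => hM (g 0 y)
  -- Given the first position, the remaining ones are a fresh i.i.d. sequence, so what is left is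
  -- again an insertion law: of the shifted sequence if the position is old, of the same sequence if
  -- it is new.
  have hinner : ∀ᵐ x ∂(volume : Measure unitInterval).prod ν,
      ∫ w, Φ (backLim z₀ (insertSeq (Real.exp (-δ)) g (consSeq x w)))
        ∂Measure.infinitePi (fun _ : ℕ => (volume : Measure unitInterval).prod ν) =
      if (x.1 : ℝ) ≤ Real.exp (-δ) then A else B x.2 := by
    filter_upwards [Measure.quasiMeasurePreserving_snd.ae hν] with x hx
    split_ifs with h
    · rw [hA, integral_insertLaw hev (hgf _)]
      refine integral_congr_ae ?_
      filter_upwards [ae_forall_snd_mem hν] with w hw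
      rw [insertSeq_cons_of_le g w h, backLim_consSeq _
        (H.tendsto_backLim (insertSeq_mem (fun n => hg _) hw) z₀ z₀)]
    · simp only [hB]
      rw [integral_insertLaw hev (hgf _)]
      refine integral_congr_ae ?_
      filter_upwards [ae_forall_snd_mem hν] with w hw
      rw [insertSeq_cons_of_lt g w (not_le.1 h), backLim_consSeq _
        (H.tendsto_backLim (insertSeq_mem hg hw) z₀ z₀)]
  rw [integral_congr_ae hinner, integral_prod (fun x : unitInterval × LipFun =>
    if (x.1 : ℝ) ≤ Real.exp (-δ) then A else B x.2) (integrable_of_measurable_of_abs_le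
    (Measurable.ite hle measurable_const (hBm.comp measurable_snd)) (M := M) fun x => by
      split_ifs
      exacts [hAM, hBM _])]
  rw [← integral_unitInterval_ite ha0 ha1]
  refine integral_congr_ae (ae_of_all _ fun u => ?_)
  dsimp only
  split_ifs
  · simp
  · rfl

/-- The recursion of the deletion laws: the first function is kept with probability `e^{-δ}`. -/
lemma integral_deleteLaw_recursion (hev : ∀ x : ℝ, Measurable (fun f : LipFun => f x))
    (H : ContractsOn c K 𝓕) (z₀ : ℝ) {δ : ℝ} (hδ : 0 < δ)
    {g : ℕ → LipFun} (hg : ∀ n, g n ∈ 𝓕) {Φ : ℝ → ℝ} (hΦ : Measurable Φ) {M : ℝ}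
    (hM : ∀ x, |Φ x| ≤ M) :
    ∫ y, Φ y ∂(deleteLaw z₀ δ g) =
      Real.exp (-δ) * ∫ y, Φ (g 0 y) ∂(deleteLaw z₀ δ fun n => g (n + 1)) +
        (1 - Real.exp (-δ)) * ∫ y, Φ y ∂(deleteLaw z₀ δ fun n => g (n + 1)) := by
  have ha0 := (Real.exp_pos (-δ)).le
  have ha1 := Real.exp_le_one_iff.2 (neg_nonpos.2 hδ.le)
  rw [integral_deleteLaw hev hΦ, integral_infinitePi_consSeq _
    (Ψ := fun u => Φ (backLim z₀ (deleteSeq (Real.exp (-δ)) g u)))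
    (hΦ.comp (measurable_backLim_deleteSeq hev z₀ _ g)) (fun w => hM _),
    ← integral_unitInterval_ite ha0 ha1]
  refine integral_congr_ae (ae_of_all _ fun u => ?_)
  dsimp only
  have key : ∀ᵐ w ∂Measure.infinitePi (fun _ : ℕ => (volume : Measure unitInterval)),
      backLim z₀ (deleteSeq (Real.exp (-δ)) g (consSeq u w)) =
        (if (u : ℝ) ≤ Real.exp (-δ) then g 0 else LipFun.ident)
          (backLim z₀ (deleteSeq (Real.exp (-δ)) (fun n => g (n + 1)) w)) := by
    filter_upwards [ae_infinite_le (Real.exp_pos (-δ))] with w hw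
    have ht := H.tendsto_deleteSeq z₀ (g := fun n => g (n + 1)) (fun n => hg _) hw
    rw [deleteSeq_cons, backLim_consSeq _ ht, ht.limUnder_eq.symm]
    rfl
  split_ifs with h
  · rw [integral_deleteLaw hev (Φ := fun y => Φ (g 0 y)) (hΦ.comp (g 0).continuous.measurable)]
    refine integral_congr_ae (key.mono fun w hw => ?_)
    dsimp only
    rw [hw, if_pos h]
  · rw [integral_deleteLaw hev hΦ]
    refine integral_congr_ae (key.mono fun w hw => ?_)
    dsimp only
    rw [hw, if_neg h]
    rfl

/-- The insertion laws converge weakly to the infinite iteration of `g` as `δ ↓ 0`. -/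
lemma tendsto_integral_insertLaw {ν : Measure LipFun} [IsProbabilityMeasure ν]
    (hev : ∀ x : ℝ, Measurable (fun f : LipFun => f x))
    (H : ContractsOn c K 𝓕) (hν : ∀ᵐ f ∂ν, f ∈ 𝓕) (z₀ : ℝ)
    {g : ℕ → LipFun} (hg : ∀ n, g n ∈ 𝓕) {Φ : ℝ → ℝ} (hΦ : Continuous Φ) {M : ℝ}
    (hM : ∀ x, |Φ x| ≤ M) :
    Tendsto (fun δ => ∫ y, Φ y ∂(insertLaw ν z₀ δ g)) (𝓝[>] 0) (𝓝 (Φ (backLim z₀ g))) := by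
  simp only [integral_insertLaw hev hΦ.measurable]
  have : Φ (backLim z₀ g) = ∫ _, Φ (backLim z₀ g)
      ∂Measure.infinitePi (fun _ : ℕ => (volume : Measure unitInterval).prod ν) := by simp
  rw [this]
  refine tendsto_integral_filter_of_dominated_convergence (fun _ => M)
    (Eventually.of_forall fun δ =>
      (hΦ.measurable.comp (measurable_backLim_insertSeq hev z₀ _ g)).aestronglyMeasurable)
    (Eventually.of_forall fun δ => ae_of_all _ fun w => hM _) (integrable_const _) ?_
  have h1 : ∀ᵐ w ∂Measure.infinitePi (fun _ : ℕ => (volume : Measure unitInterval).prod ν),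
      ∀ k, ((w k).1 : ℝ) < 1 := by
    refine ae_forall_infinitePi _ (p := fun x : unitInterval × LipFun => (x.1 : ℝ) < 1)
      (Measure.quasiMeasurePreserving_fst.ae (p := fun u : unitInterval => (u : ℝ) < 1) ?_)
    have : ∀ᵐ u : unitInterval, u ≠ 1 := by simp [ae_iff]
    filter_upwards [this] with u hu
    exact lt_of_le_of_ne u.2.2 fun h => hu (Subtype.ext h)
  filter_upwards [h1, ae_forall_snd_mem hν] with w hw1 hw2
  refine (hΦ.tendsto _).comp (H.tendsto_of_eventually_eq hg
    (Eventually.of_forall fun δ => insertSeq_mem hg hw2) fun n => ?_)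
  filter_upwards [eventually_forall_le_exp (n := n) hw1] with δ hδ k hk
  exact insertSeq_eq_of_forall_le g hδ hk

/-- The deletion laws converge weakly to the infinite iteration of `g` as `δ ↓ 0`. -/
lemma tendsto_integral_deleteLaw (hev : ∀ x : ℝ, Measurable (fun f : LipFun => f x))
    (H : ContractsOn c K 𝓕) (z₀ : ℝ)
    {g : ℕ → LipFun} (hg : ∀ n, g n ∈ 𝓕) {Φ : ℝ → ℝ} (hΦ : Continuous Φ) {M : ℝ}
    (hM : ∀ x, |Φ x| ≤ M) :
    Tendsto (fun δ => ∫ y, Φ y ∂(deleteLaw z₀ δ g)) (𝓝[>] 0) (𝓝 (Φ (backLim z₀ g))) := by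
  simp only [integral_deleteLaw hev hΦ.measurable]
  have : Φ (backLim z₀ g) = ∫ _, Φ (backLim z₀ g)
      ∂Measure.infinitePi (fun _ : ℕ => (volume : Measure unitInterval)) := by simp
  rw [this]
  refine tendsto_integral_filter_of_dominated_convergence (fun _ => M)
    (Eventually.of_forall fun δ =>
      (hΦ.measurable.comp (measurable_backLim_deleteSeq hev z₀ _ g)).aestronglyMeasurable)
    (Eventually.of_forall fun δ => ae_of_all _ fun w => hM _) (integrable_const _) ?_
  -- Infinitely many labels below the single level `e^{-1}` provide infinitely many kept functions
  -- for all `δ < 1` outside one null set.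
  filter_upwards [ae_forall_lt_one, ae_infinite_le (Real.exp_pos (-1))] with u hu1 hu2
  have hinf : ∀ᶠ δ in 𝓝[>] (0 : ℝ), {k | (u k : ℝ) ≤ Real.exp (-δ)}.Infinite := by
    have : ∀ᶠ δ in 𝓝[>] (0 : ℝ), δ < 1 :=
      (eventually_lt_nhds zero_lt_one).filter_mono nhdsWithin_le_nhds
    filter_upwards [this] with δ hδ
    exact hu2.mono fun k (hk : (u k : ℝ) ≤ _) =>
      hk.trans (Real.exp_le_exp.2 (neg_le_neg hδ.le))
  refine (hΦ.tendsto _).comp (Tendsto.congr' (hinf.mono fun δ hδ =>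
    (H.backLim_deleteSeq z₀ hg hδ).symm) (H.tendsto_of_eventually_eq hg
    (Eventually.of_forall fun δ n => hg _) fun n => ?_))
  filter_upwards [eventually_forall_le_exp (n := n) hu1, hinf] with δ hδ hi k hk
  classical
  congr 1
  have hcount : Nat.count (fun k => (u k : ℝ) ≤ Real.exp (-δ)) k = k := by
    rw [Nat.count_eq_card_filter_range, Finset.filter_true_of_mem, Finset.card_range]
    exact fun i hi => hδ i ((Finset.mem_range.1 hi).trans hk)
  conv_lhs => rw [← hcount]
  exact Nat.nth_count (p := fun k => (u k : ℝ) ≤ Real.exp (-δ)) (hδ k hk)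

end Laws

/-! ### Generators -/

/-- Tietze extension. The transition laws charge only `K`, so the extension may replace `h` and
makes integrability and weak convergence available on all of `ℝ`. -/
lemma exists_bounded_continuous_eqOn {K : Set ℝ} (hK : IsCompact K) {h : ℝ → ℝ}
    (hc : ContinuousOn h K) :
    ∃ (Φ : ℝ → ℝ) (M : ℝ), Continuous Φ ∧ (∀ x, |Φ x| ≤ M) ∧ EqOn Φ h K := by
  have : CompactSpace K := isCompact_iff_compactSpace.1 hK
  obtain ⟨G, -, hG⟩ := BoundedContinuousFunction.exists_norm_eq_domRestrict_eq_of_closed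
    (BoundedContinuousFunction.mkOfCompact ⟨K.domRestrict h, hc.domRestrict⟩) hK.isClosed
  exact ⟨G, ‖G‖, G.continuous, fun x => G.norm_coe_le_norm x, fun x hx =>
    congrArg (fun F => F (⟨x, hx⟩ : K)) hG⟩

/-- On a compact set, a `C¹` function satisfies a Lipschitz estimate at each point. -/
lemma exists_abs_sub_le_of_contDiffOn {K : Set ℝ} (hK : IsCompact K) {h : ℝ → ℝ}
    (hc : ContDiffOn ℝ 1 h K) {z : ℝ} (hz : z ∈ K) :
    ∃ L, 0 ≤ L ∧ ∀ w ∈ K, |h w - h z| ≤ L * |w - z| := by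
  obtain ⟨C, hC⟩ := ((hc.differentiableOn one_ne_zero) z hz).isBigO_sub.bound
  obtain ⟨ε, hε, hball⟩ := Metric.mem_nhdsWithin_iff.1 hC
  obtain ⟨M, hM⟩ := hK.exists_bound_of_continuousOn hc.continuousOn
  have hM0 : 0 ≤ M := (norm_nonneg _).trans (hM z hz)
  -- `C` serves within distance `ε` of `z`, by differentiability there; farther away the oscillation
  -- `2 * M` is at most `2 * M / ε` times the distance.
  refine ⟨max |C| (2 * M / ε), le_max_of_le_left (abs_nonneg _), fun w hw => ?_⟩
  rcases lt_or_ge |w - z| ε with hlt | hge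
  · have : ‖h w - h z‖ ≤ C * ‖w - z‖ := hball ⟨hlt, hw⟩
    exact this.trans (mul_le_mul_of_nonneg_right ((le_abs_self C).trans (le_max_left _ _))
      (abs_nonneg _))
  · calc |h w - h z| ≤ |h w| + |h z| := abs_sub _ _
      _ ≤ 2 * M := by linarith [hM w hw, hM z hz, Real.norm_eq_abs (h w), Real.norm_eq_abs (h z)]
      _ = 2 * M / ε * ε := by field_simp
      _ ≤ _ := by gcongr; exact le_max_right _ _

section Generators

variable [MeasurableSpace LipFun] {ν : Measure LipFun} [IsProbabilityMeasure ν] {c : ℝ}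
  {K : Set ℝ} {𝓕 : Set LipFun}

/-- The generator of the insertion laws on bounded continuous functions with a Lipschitz
estimate at `z`. -/
lemma insertLaw_generator (hev : ∀ x : ℝ, Measurable (fun f : LipFun => f x))
    (H : ContractsOn c K 𝓕) (hν : ∀ᵐ f ∂ν, f ∈ 𝓕) (z₀ : ℝ) {g : ℕ → LipFun}
    (hg : ∀ n, g n ∈ 𝓕) {Φ : ℝ → ℝ} (hΦ : Continuous Φ) {M L : ℝ} (hM : ∀ x, |Φ x| ≤ M)
    (hL0 : 0 ≤ L) (hL : ∀ w ∈ K, |Φ w - Φ (backLim z₀ g)| ≤ L * |w - backLim z₀ g|) :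
    Summable (fun k => (∫ f, Φ (backIter g k (f (backLim z₀ fun n => g (k + n)))) ∂ν) -
      Φ (backLim z₀ g)) ∧
    Tendsto (fun δ => δ⁻¹ * ((∫ y, Φ y ∂(insertLaw ν z₀ δ g)) - Φ (backLim z₀ g))) (𝓝[>] 0)
      (𝓝 (∑' k, ((∫ f, Φ (backIter g k (f (backLim z₀ fun n => g (k + n)))) ∂ν) -
        Φ (backLim z₀ g)))) := by
  have hgk : ∀ k n, g (k + n) ∈ 𝓕 := fun k n => hg _
  have hb : ∀ k, Measurable fun y => Φ (backIter g k y) := fun k =>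
    hΦ.measurable.comp (continuous_backIter g k).measurable
  have hK : ∀ k, ∀ y ∈ K, |Φ (backIter g k y) - Φ (backLim z₀ g)| ≤
      L * Metric.diam K * c ^ k := fun k y hy => by
    refine (hL _ (H.mapsTo_backIter hg k hy)).trans ?_
    rw [mul_assoc, mul_comm (Metric.diam K)]
    refine mul_le_mul_of_nonneg_left ?_ hL0
    rw [H.backLim_eq_backIter hg z₀ k]
    exact H.abs_backIter_sub_le_diam hg k hy (H.backLim_mem (hgk k) z₀)
  have hprob : ∀ δ k, IsProbabilityMeasure (insertLaw ν z₀ δ fun n => g (k + n)) := fun δ k =>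
    isProbabilityMeasure_insertLaw hev z₀ δ _
  have hmeas : ∀ δ k, Measurable fun f : LipFun =>
      ∫ y, Φ (backIter g k (f y)) ∂(insertLaw ν z₀ δ fun n => g (k + n)) := fun δ k =>
    ((measurable_comp_uncurry hev (hb k)).stronglyMeasurable.integral_prod_right
      (ν := insertLaw ν z₀ δ fun n => g (k + n))).measurable
  -- `r δ k` describes the state after `k` old functions with nothing inserted, `s δ k` the same
  -- with a new function inserted next, and `S k` the latter without further insertions.
  have := tendsto_of_geometric_recursion
    (r := fun δ k => ∫ y, Φ (backIter g k y) ∂(insertLaw ν z₀ δ fun n => g (k + n)))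
    (s := fun δ k => ∫ f, ∫ y, Φ (backIter g k (f y)) ∂(insertLaw ν z₀ δ fun n => g (k + n)) ∂ν)
    (S := fun k => ∫ f, Φ (backIter g k (f (backLim z₀ fun n => g (k + n)))) ∂ν)
    (v := Φ (backLim z₀ g)) (C := L * Metric.diam K) H.nonneg H.lt_one
    (fun δ hδ k => ?_) (fun δ hδ k => ?_) (fun δ hδ k => ?_) (fun k => ?_)
  · refine ⟨this.1, ?_⟩
    simpa only [zero_add, backIter, id] using this.2
  · have h1 : (fun n => g (k + (n + 1))) = fun n => g (k + 1 + n) := by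
      funext n
      congr 1
      omega
    have := integral_insertLaw_recursion hev H hν z₀ hδ (hgk k) (hb k) fun x => hM _
    rw [h1] at this
    exact this
  · refine abs_integral_sub_le (integrable_of_measurable_of_abs_le (hb k) fun _ => hM _) ?_
    exact (ae_mem_insertLaw hev H hν z₀ δ (hgk k)).mono fun y hy => hK k y hy
  · refine abs_integral_sub_le (integrable_of_measurable_of_abs_le (hmeas δ k) fun f =>
      abs_integral_le fun y => hM _) ?_
    filter_upwards [hν] with f hf
    refine abs_integral_sub_le (integrable_of_measurable_of_abs_le
      ((hb k).comp f.continuous.measurable) fun _ => hM _) ?_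
    exact (ae_mem_insertLaw hev H hν z₀ δ (hgk k)).mono fun y hy => hK k _ (H.mapsTo f hf hy)
  · refine tendsto_integral_filter_of_dominated_convergence (fun _ => M)
      (Eventually.of_forall fun δ => (hmeas δ k).aestronglyMeasurable)
      (Eventually.of_forall fun δ => ae_of_all _ fun f => abs_integral_le fun y => hM _)
      (integrable_const _) (ae_of_all _ fun f => ?_)
    exact tendsto_integral_insertLaw hev H hν z₀ (hgk k)
      (Φ := fun y => Φ (backIter g k (f y)))
      (hΦ.comp ((continuous_backIter g k).comp f.continuous)) fun _ => hM _

/-- The generator of the deletion laws on bounded continuous functions with a Lipschitz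
estimate at `z`. -/
lemma deleteLaw_generator (hev : ∀ x : ℝ, Measurable (fun f : LipFun => f x))
    (H : ContractsOn c K 𝓕) (z₀ : ℝ) {g : ℕ → LipFun}
    (hg : ∀ n, g n ∈ 𝓕) {Φ : ℝ → ℝ} (hΦ : Continuous Φ) {M L : ℝ} (hM : ∀ x, |Φ x| ≤ M)
    (hL0 : 0 ≤ L) (hL : ∀ w ∈ K, |Φ w - Φ (backLim z₀ g)| ≤ L * |w - backLim z₀ g|) :
    Summable (fun k => Φ (backIter g k (backLim z₀ fun n => g (k + 1 + n))) -
      Φ (backLim z₀ g)) ∧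
    Tendsto (fun δ => δ⁻¹ * ((∫ y, Φ y ∂(deleteLaw z₀ δ g)) - Φ (backLim z₀ g))) (𝓝[>] 0)
      (𝓝 (∑' k, (Φ (backIter g k (backLim z₀ fun n => g (k + 1 + n))) -
        Φ (backLim z₀ g)))) := by
  have hgk : ∀ k n, g (k + n) ∈ 𝓕 := fun k n => hg _
  have hb : ∀ k, Measurable fun y => Φ (backIter g k y) := fun k =>
    hΦ.measurable.comp (continuous_backIter g k).measurable
  have hK : ∀ k, ∀ y ∈ K, |Φ (backIter g k y) - Φ (backLim z₀ g)| ≤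
      L * Metric.diam K * c ^ k := fun k y hy => by
    refine (hL _ (H.mapsTo_backIter hg k hy)).trans ?_
    rw [mul_assoc, mul_comm (Metric.diam K)]
    refine mul_le_mul_of_nonneg_left ?_ hL0
    rw [H.backLim_eq_backIter hg z₀ k]
    exact H.abs_backIter_sub_le_diam hg k hy (H.backLim_mem (hgk k) z₀)
  have hprob : ∀ δ k, IsProbabilityMeasure (deleteLaw z₀ δ fun n => g (k + n)) := fun δ k =>
    isProbabilityMeasure_deleteLaw hev z₀ δ _
  -- `r δ k` has the first `k` functions kept, `s δ k` has in addition function `k` deleted, and `S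
  -- k` has no further deletions.
  have := tendsto_of_geometric_recursion
    (r := fun δ k => ∫ y, Φ (backIter g k y) ∂(deleteLaw z₀ δ fun n => g (k + n)))
    (s := fun δ k => ∫ y, Φ (backIter g k y) ∂(deleteLaw z₀ δ fun n => g (k + 1 + n)))
    (S := fun k => Φ (backIter g k (backLim z₀ fun n => g (k + 1 + n))))
    (v := Φ (backLim z₀ g)) (C := L * Metric.diam K) H.nonneg H.lt_one
    (fun δ hδ k => ?_) (fun δ hδ k => ?_) (fun δ hδ k => ?_) (fun k => ?_)
  · refine ⟨this.1, ?_⟩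
    simpa only [zero_add, backIter, id] using this.2
  · have h1 : (fun n => g (k + (n + 1))) = fun n => g (k + 1 + n) := by
      funext n
      congr 1
      omega
    have := integral_deleteLaw_recursion hev H z₀ hδ (hgk k) (hb k) fun x => hM _
    rw [h1] at this
    exact this
  · refine abs_integral_sub_le (integrable_of_measurable_of_abs_le (hb k) fun _ => hM _) ?_
    exact (ae_mem_deleteLaw hev H z₀ δ (hgk k)).mono fun y hy => hK k y hy
  · refine abs_integral_sub_le (integrable_of_measurable_of_abs_le (hb k) fun _ => hM _) ?_
    exact (ae_mem_deleteLaw hev H z₀ δ (hgk (k + 1))).mono fun y hy => hK k y hy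
  · exact tendsto_integral_deleteLaw hev H z₀ (hgk (k + 1))
      (Φ := fun y => Φ (backIter g k y)) (hΦ.comp (continuous_backIter g k)) fun _ => hM _

/-- The forward and reverse generators of the insertion and deletion laws. -/
lemma generators (hev : ∀ x : ℝ, Measurable (fun f : LipFun => f x)) {z₀ : ℝ}
    {g : ℝ → ℕ → LipFun} (hrec : HasRecovery ν z₀ K 𝓕 g) (H : ContractsOn c K 𝓕)
    {h : ℝ → ℝ} (hh : ContDiffOn ℝ 1 h K) {z : ℝ} (hz : z ∈ K) :
    (∀ k, Integrable (fun f : LipFun => h (conjInsert K (g z) k f z)) ν) ∧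
      Summable (fun k : ℕ => (∫ f, h (conjInsert K (g z) k f z) ∂ν) - h z) ∧
      IsGeneratorValue (fun δ z => insertLaw ν z₀ δ (g z)) h z
        (∑' k : ℕ, ((∫ f, h (conjInsert K (g z) k f z) ∂ν) - h z)) ∧
      Summable (fun k : ℕ => h (conjDelete K (g z) k z) - h z) ∧
      IsGeneratorValue (fun δ z => deleteLaw z₀ δ (g z)) h z
        (∑' k : ℕ, (h (conjDelete K (g z) k z) - h z)) := by
  obtain ⟨Φ, M, hΦ, hM, hEq⟩ := exists_bounded_continuous_eqOn H.isCompact hh.continuousOn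
  obtain ⟨L, hL0, hL⟩ := exists_abs_sub_le_of_contDiffOn H.isCompact hh hz
  have hν := hrec.ae_mem
  have hg := hrec.mem z hz
  have hlim : backLim z₀ (g z) = z := hrec.backLim_eq hz
  have hL' : ∀ w ∈ K, |Φ w - Φ (backLim z₀ (g z))| ≤ L * |w - backLim z₀ (g z)| := fun w hw => by
    rw [hlim, hEq hw, hEq hz]
    exact hL w hw
  have hzk : ∀ k, (backLim z₀ fun n => g z (k + n)) ∈ K := fun k =>
    H.backLim_mem (fun n => hg _) z₀
  obtain ⟨hi1, hi2⟩ := insertLaw_generator hev H hν z₀ hg hΦ hM hL0 hL'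
  obtain ⟨hd1, hd2⟩ := deleteLaw_generator hev H z₀ hg hΦ hM hL0 hL'
  have hins : ∀ k, (fun f : LipFun => h (conjInsert K (g z) k f z)) =ᵐ[ν]
      fun f => Φ (backIter (g z) k (f (backLim z₀ fun n => g z (k + n)))) := fun k => by
    filter_upwards [hν] with f hf
    rw [hrec.conjInsert_eq H hz, hEq (H.mapsTo_backIter hg k (H.mapsTo f hf (hzk k)))]
  have hI : ∀ k, ∫ f, h (conjInsert K (g z) k f z) ∂ν =
      ∫ f, Φ (backIter (g z) k (f (backLim z₀ fun n => g z (k + n)))) ∂ν := fun k =>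
    integral_congr_ae (hins k)
  have hD : ∀ k, h (conjDelete K (g z) k z) =
      Φ (backIter (g z) k (backLim z₀ fun n => g z (k + 1 + n))) := fun k => by
    rw [hrec.conjDelete_eq H hz, hEq (H.mapsTo_backIter hg k (hzk (k + 1)))]
  have hv : h z = Φ (backLim z₀ (g z)) := by rw [hlim, hEq hz]
  have hEi : ∀ δ, h =ᵐ[insertLaw ν z₀ δ (g z)] Φ := fun δ =>
    (ae_mem_insertLaw hev H hν z₀ δ hg).mono fun y hy => (hEq hy).symm
  have hEd : ∀ δ, h =ᵐ[deleteLaw z₀ δ (g z)] Φ := fun δ =>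
    (ae_mem_deleteLaw hev H z₀ δ hg).mono fun y hy => (hEq hy).symm
  refine ⟨fun k => ?_, ?_, ⟨fun δ _ => ?_, ?_⟩, ?_, ⟨fun δ _ => ?_, ?_⟩⟩
  · refine Integrable.congr ?_ (hins k).symm
    exact integrable_of_measurable_of_abs_le (hΦ.measurable.comp
      ((continuous_backIter _ k).measurable.comp (hev _))) fun _ => hM _
  · simpa only [hI, hv] using hi1
  · have := isProbabilityMeasure_insertLaw (ν := ν) hev z₀ δ (g z)
    exact (integrable_of_measurable_of_abs_le hΦ.measurable hM).congr (hEi δ).symm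
  · simp only [hI, hv, integral_congr_ae (hEi _)]
    exact hi2
  · simpa only [hD, hv] using hd1
  · have := isProbabilityMeasure_deleteLaw hev z₀ δ (g z)
    exact (integrable_of_measurable_of_abs_le hΦ.measurable hM).congr (hEd δ).symm
  · simp only [hD, hv, integral_congr_ae (hEd _)]
    exact hd2

end Generators

/-! ### Resampling i.i.d. sequences, and conditional laws -/

/-- Integrals over i.i.d. sequences, by conditioning on the first element. -/
lemma lintegral_infinitePi_consSeq {X : Type*} [MeasurableSpace X] (μ : Measure X)
    [IsProbabilityMeasure μ] {Ψ : (ℕ → X) → ENNReal} (hΨ : Measurable Ψ) :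
    ∫⁻ w, Ψ w ∂Measure.infinitePi (fun _ : ℕ => μ) =
      ∫⁻ x, ∫⁻ w, Ψ (consSeq x w) ∂Measure.infinitePi (fun _ : ℕ => μ) ∂μ := by
  conv_lhs => rw [← map_consSeq_infinitePi μ]
  rw [lintegral_map hΨ measurable_consSeq]
  exact lintegral_prod _ (hΨ.comp measurable_consSeq).aemeasurable

lemma infinitePi_apply_consSeq {X : Type*} [MeasurableSpace X] (μ : Measure X)
    [IsProbabilityMeasure μ] {E : Set (ℕ → X)} (hE : MeasurableSet E) :
    Measure.infinitePi (fun _ : ℕ => μ) E =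
      (μ.prod (Measure.infinitePi fun _ : ℕ => μ)) {p | consSeq p.1 p.2 ∈ E} := by
  conv_lhs => rw [← map_consSeq_infinitePi μ]
  rw [Measure.map_apply measurable_consSeq hE]
  rfl

lemma forall_lt_succ_consSeq {X : Type*} (t : ℕ → Set X) (n : ℕ) (x : X) (w : ℕ → X) :
    (∀ i < n + 1, consSeq x w i ∈ t i) ↔ x ∈ t 0 ∧ ∀ i < n, w i ∈ t (i + 1) := by
  refine ⟨fun h => ⟨h 0 (by omega), fun i hi => h (i + 1) (by omega)⟩, fun h i hi => ?_⟩
  cases i with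
  | zero => exact h.1
  | succ i => exact h.2 i (by omega)

/-- The labels of `w` together with the functions obtained from `χ` by inserting functions of `w`
at the positions with labels above `a`. -/
noncomputable def labelledInsert (a : ℝ) (χ : ℕ → LipFun) (w : ℕ → unitInterval × LipFun) :
    ℕ → unitInterval × LipFun :=
  fun k => ((w k).1, insertSeq a χ w k)

lemma labelledInsert_cons_of_le {a : ℝ} (f : LipFun) (χ : ℕ → LipFun)
    {x : unitInterval × LipFun} (w : ℕ → unitInterval × LipFun) (hx : (x.1 : ℝ) ≤ a) :
    labelledInsert a (consSeq f χ) (consSeq x w) = consSeq (x.1, f) (labelledInsert a χ w) := by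
  funext k
  rw [labelledInsert, insertSeq_cons_of_le _ _ hx]
  cases k <;> rfl

lemma labelledInsert_cons_of_lt {a : ℝ} (χ : ℕ → LipFun)
    {x : unitInterval × LipFun} (w : ℕ → unitInterval × LipFun) (hx : a < x.1) :
    labelledInsert a χ (consSeq x w) = consSeq x (labelledInsert a χ w) := by
  funext k
  rw [labelledInsert, insertSeq_cons_of_lt _ _ hx]
  cases k <;> rfl

section Insertion

variable [MeasurableSpace LipFun]

lemma measurable_labelledInsert (a : ℝ) :
    Measurable fun p : (ℕ → LipFun) × (ℕ → unitInterval × LipFun) =>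
      labelledInsert a p.1 p.2 := by
  refine measurable_pi_lambda _ fun k => Measurable.prodMk ?_ ?_
  · fun_prop
  · exact (measurable_pi_apply k).comp (measurable_insertSeq a)

/-- Inserting independent functions into an i.i.d. sequence gives an i.i.d. sequence which is
independent of the pattern of insertions. -/
lemma map_labelledInsert (ν : Measure LipFun) [IsProbabilityMeasure ν] (a : ℝ) :
    ((Measure.infinitePi fun _ : ℕ => ν).prod
      (Measure.infinitePi fun _ : ℕ => (volume : Measure unitInterval).prod ν)).map
        (fun p => labelledInsert a p.1 p.2) =
      Measure.infinitePi fun _ : ℕ => (volume : Measure unitInterval).prod ν := by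
  set μ := (volume : Measure unitInterval).prod ν with hμ
  refine eq_infinitePi_of_range μ fun n t ht => ?_
  rw [Measure.map_apply (measurable_labelledInsert a) (measurableSet_range_box n ht)]
  have hms : ∀ (n : ℕ) (t : ℕ → Set (unitInterval × LipFun)), (∀ i, MeasurableSet (t i)) →
      MeasurableSet ((fun p : (ℕ → LipFun) × (ℕ → unitInterval × LipFun) =>
        labelledInsert a p.1 p.2) ⁻¹' {w | ∀ i < n, w i ∈ t i}) := fun n t ht =>
    measurable_labelledInsert a (measurableSet_range_box n ht)
  induction n generalizing t with
  | zero => simp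
  | succ n ih =>
    have ih' := ih (fun i => t (i + 1)) fun i => ht (i + 1)
    rw [Measure.prod_apply_symm (hms _ _ fun i => ht (i + 1))] at ih'
    have hmf := measurable_measure_prodMk_right (μ := Measure.infinitePi fun _ : ℕ => ν)
      (hms (n + 1) t ht)
    rw [Measure.prod_apply_symm (hms _ _ ht), lintegral_infinitePi_consSeq μ hmf]
    set Q := ∏ i ∈ Finset.range n, μ (t (i + 1)) with hQ
    -- Conditioning on the first entry of `w`: a small label uses up the first entry of `χ`, a large
    -- one leaves `χ` untouched. In both cases the rest is independent with the law of the induction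
    -- hypothesis.
    have hinner : ∀ x : unitInterval × LipFun,
        ∫⁻ w, (Measure.infinitePi fun _ : ℕ => ν) ((fun χ => (χ, consSeq x w)) ⁻¹'
          ((fun p : (ℕ → LipFun) × (ℕ → unitInterval × LipFun) => labelledInsert a p.1 p.2) ⁻¹'
            {w | ∀ i < n + 1, w i ∈ t i})) ∂Measure.infinitePi (fun _ : ℕ => μ) =
        (if (x.1 : ℝ) ≤ a then ν {f | (x.1, f) ∈ t 0} else (t 0).indicator 1 x) * Q := by
      intro x
      split_ifs with hx
      · rw [← ih', ← lintegral_const_mul _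
          (measurable_measure_prodMk_right (hms n _ fun i => ht (i + 1)))]
        refine lintegral_congr fun w => ?_
        rw [infinitePi_apply_consSeq ν (hms (n + 1) t ht |>.preimage (by fun_prop)),
          ← Measure.prod_prod]
        congr 1
        ext ⟨f, χ⟩
        simp only [mem_preimage, mem_ofPred_eq, mem_prod, labelledInsert_cons_of_le f χ w hx,
          forall_lt_succ_consSeq]
      · by_cases hxt : x ∈ t 0
        · rw [indicator_of_mem hxt, Pi.one_apply, one_mul, ← ih']
          refine lintegral_congr fun w => ?_
          congr 1
          ext χ
          simp only [mem_preimage, mem_ofPred_eq, labelledInsert_cons_of_lt χ w (not_le.1 hx),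
            forall_lt_succ_consSeq, hxt, true_and]
        · rw [indicator_of_notMem hxt, zero_mul]
          simp only [preimage_ofPred_eq, labelledInsert_cons_of_lt _ _ (not_le.1 hx),
            forall_lt_succ_consSeq, hxt, false_and]
          simp
    have hsec : Measurable fun u : unitInterval => ν {f | (u, f) ∈ t 0} :=
      measurable_measure_prodMk_left (ht 0)
    have hle : MeasurableSet {x : unitInterval × LipFun | (x.1 : ℝ) ≤ a} :=
      measurableSet_le (by fun_prop) measurable_const
    have hfirst : Measurable fun x : unitInterval × LipFun =>
        if (x.1 : ℝ) ≤ a then ν {f | (x.1, f) ∈ t 0} else (t 0).indicator 1 x :=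
      Measurable.ite hle (hsec.comp measurable_fst) (measurable_one.indicator (ht 0))
    simp only [hinner]
    rw [lintegral_mul_const _ hfirst, Finset.prod_range_succ', ← hQ, mul_comm]
    congr 1
    rw [hμ, lintegral_prod _ hfirst.aemeasurable, Measure.prod_apply (ht 0)]
    -- For each label `u` both branches give the `ν`-measure of the section of `t 0`: the old and
    -- the new function have the same law.
    refine lintegral_congr fun u => ?_
    by_cases hu : (u : ℝ) ≤ a
    · simp only [hu, if_true, lintegral_const, measure_univ, mul_one]
      rfl
    · simp only [hu, if_false]
      rw [← lintegral_indicator_one (measurable_prodMk_left (ht 0))]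
      rfl

end Insertion

/-- Conditional laws from a representation with an independent random element. -/
lemma isCondLawOn_of_map_eq {Ω A : Type*} [MeasurableSpace Ω] [MeasurableSpace A] {P : Measure Ω}
    [IsProbabilityMeasure P] {X Y : Ω → ℝ} {K : Set ℝ} {q : ℝ → Measure ℝ}
    (ρ : Measure ℝ) [IsProbabilityMeasure ρ] (hρ : ∀ᵐ z ∂ρ, z ∈ K) (m : Measure A)
    [IsProbabilityMeasure m] {F : ℝ × A → ℝ} (hF : Measurable F)
    (hq : ∀ z ∈ K, m.map (fun a => F (z, a)) = q z) (hX : AEMeasurable X P)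
    (hY : AEMeasurable Y P)
    (hmap : P.map (fun ω => (X ω, Y ω)) = (ρ.prod m).map (fun p => (p.1, F p))) :
    IsCondLawOn P Y X K q := by
  -- The law of `F (z, ·)` under `m`, a kernel on all of `ℝ` although `q` is prescribed only on `K`.
  let κ : Kernel ℝ ℝ := (Kernel.id ×ₖ Kernel.const ℝ m).map F
  have hκ : ∀ z, κ z = m.map (fun a => F (z, a)) := fun z => by
    rw [Kernel.map_apply _ hF, Kernel.prod_apply, Kernel.id_apply, Kernel.const_apply,
      Measure.dirac_prod, Measure.map_map hF measurable_prodMk_left]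
    rfl
  have hmX : P.map X = ρ := by
    have h1 : P.map X = (P.map (fun ω => (X ω, Y ω))).map Prod.fst := by
      rw [AEMeasurable.map_map_of_aemeasurable measurable_fst.aemeasurable (hX.prodMk hY)]
      rfl
    have h2 : (Prod.fst ∘ fun p : ℝ × A => (p.1, F p)) = Prod.fst := rfl
    rw [h1, hmap, Measure.map_map measurable_fst (measurable_fst.prodMk hF), h2,
      Measure.map_fst_prod]
    simp
  refine ⟨?_, κ, Kernel.IsMarkovKernel.map _ hF, fun z hz => (hκ z).trans (hq z hz), ?_⟩
  · exact ae_of_ae_map hX (p := (· ∈ K)) (by rwa [hmX])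
  · refine ⟨hX.prodMk hY, ?_⟩
    have : IsMarkovKernel κ := Kernel.IsMarkovKernel.map _ hF
    rw [hmap, hmX]
    ext s hs
    rw [Measure.map_apply (measurable_fst.prodMk hF) hs, Measure.compProd_apply hs,
      Measure.prod_apply (measurable_fst.prodMk hF hs)]
    refine lintegral_congr fun z => ?_
    have hFz : Measurable fun a => F (z, a) := hF.comp measurable_prodMk_left
    rw [hκ, Measure.map_apply hFz (measurable_prodMk_left hs)]
    rfl

-- Selecting the positions with small labels undoes the insertion, so the kept subsequence of
-- `labelledInsert a χ w` is `χ`.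
open Classical in
lemma insertSeq_nth {a : ℝ} (χ : ℕ → LipFun) {w : ℕ → unitInterval × LipFun}
    (hw : {k | ((w k).1 : ℝ) ≤ a}.Infinite) (j : ℕ) :
    insertSeq a χ w (Nat.nth (fun k => ((w k).1 : ℝ) ≤ a) j) = χ j := by
  rw [insertSeq_eq_count, if_pos (Nat.nth_mem_of_infinite hw j), Nat.count_nth_of_infinite hw]

section CondLaw

variable {Ω : Type*} [MeasurableSpace Ω] {P : Measure Ω}
  [MeasurableSpace LipFun] {ν : Measure LipFun} [IsProbabilityMeasure ν] {c : ℝ}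
  {K : Set ℝ} {𝓕 : Set LipFun} {z₀ : ℝ} {g : ℝ → ℕ → LipFun}
  {W : Ω → ℕ → unitInterval × LipFun}

lemma isProbabilityMeasure_limitLaw (hev : ∀ x : ℝ, Measurable (fun f : LipFun => f x)) :
    IsProbabilityMeasure (limitLaw ν z₀) :=
  Measure.isProbabilityMeasure_map (measurable_backLim hev z₀).aemeasurable

lemma ae_mem_limitLaw (hev : ∀ x : ℝ, Measurable (fun f : LipFun => f x))
    (H : ContractsOn c K 𝓕) (hν : ∀ᵐ f ∂ν, f ∈ 𝓕) : ∀ᵐ z ∂limitLaw ν z₀, z ∈ K := by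
  rw [limitLaw, ae_map_iff (p := (· ∈ K)) (measurable_backLim hev z₀).aemeasurable
    H.isCompact.measurableSet]
  filter_upwards [ae_forall_infinitePi ν hν] with χ hχ
  exact H.backLim_mem hχ z₀

/-- Joint laws of functionals of an i.i.d. sequence that is represented by `T χ w`, where the
first functional recovers the limit of `χ`. -/
lemma map_prodMk_eq_of_representation (hev : ∀ x : ℝ, Measurable (fun f : LipFun => f x))
    (hW : AEMeasurable W P)
    (hlaw : P.map W = Measure.infinitePi fun _ : ℕ => (volume : Measure unitInterval).prod ν)
    {T : (ℕ → LipFun) × (ℕ → unitInterval × LipFun) → ℕ → unitInterval × LipFun}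
    (hTm : Measurable T)
    (hT : ((Measure.infinitePi fun _ : ℕ => ν).prod
      (Measure.infinitePi fun _ : ℕ => (volume : Measure unitInterval).prod ν)).map T =
        Measure.infinitePi fun _ : ℕ => (volume : Measure unitInterval).prod ν)
    {U V : (ℕ → unitInterval × LipFun) → ℝ} (hU : Measurable U) (hV : Measurable V)
    {F : ℝ × (ℕ → unitInterval × LipFun) → ℝ} (hF : Measurable F)
    (hUV : ∀ᵐ p ∂(Measure.infinitePi fun _ : ℕ => ν).prod
      (Measure.infinitePi fun _ : ℕ => (volume : Measure unitInterval).prod ν),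
      U (T p) = backLim z₀ p.1 ∧ V (T p) = F (backLim z₀ p.1, p.2)) :
    P.map (fun ω => (U (W ω), V (W ω))) = ((limitLaw ν z₀).prod
      (Measure.infinitePi fun _ : ℕ => (volume : Measure unitInterval).prod ν)).map
        (fun p => (p.1, F p)) := by
  have h1 : P.map (fun ω => (U (W ω), V (W ω))) = (P.map W).map fun w => (U w, V w) := by
    rw [AEMeasurable.map_map_of_aemeasurable (hU.prodMk hV).aemeasurable hW]
    rfl
  have hb := measurable_backLim hev z₀
  have h2 : (limitLaw ν z₀).prod
      (Measure.infinitePi fun _ : ℕ => (volume : Measure unitInterval).prod ν) =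
      ((Measure.infinitePi fun _ : ℕ => ν).prod
        (Measure.infinitePi fun _ : ℕ => (volume : Measure unitInterval).prod ν)).map
          (Prod.map (backLim z₀) id) := by
    rw [limitLaw, ← Measure.map_prod_map _ _ hb measurable_id, Measure.map_id]
  rw [h1, hlaw, h2]
  conv_lhs => rw [← hT]
  rw [Measure.map_map (hU.prodMk hV) hTm,
    Measure.map_map (measurable_fst.prodMk hF) (hb.prodMap measurable_id)]
  refine Measure.map_congr (hUV.mono fun p hp => ?_)
  simp only [Function.comp_apply, Prod.map, id, hp.1, hp.2]

/-- The limit of the subsequence of functions with labels at most `a`. -/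
noncomputable def keptLim (z₀ a : ℝ) (w : ℕ → unitInterval × LipFun) : ℝ :=
  backLim z₀ (deleteSeq a (fun k => (w k).2) fun k => (w k).1)

/-- The limit of the whole sequence of functions. -/
noncomputable def fullLim (z₀ : ℝ) (w : ℕ → unitInterval × LipFun) : ℝ := backLim z₀ fun k => (w k).2

lemma measurable_keptLim (hev : ∀ x : ℝ, Measurable (fun f : LipFun => f x)) (a : ℝ) :
    Measurable (keptLim z₀ a) :=
  (measurable_backLim hev z₀).comp ((measurable_deleteSeq a).comp
    (f := fun w : ℕ → unitInterval × LipFun => (fun k => (w k).2, fun k => (w k).1)) (by fun_prop))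

lemma measurable_fullLim (hev : ∀ x : ℝ, Measurable (fun f : LipFun => f x)) :
    Measurable (fullLim z₀) :=
  (measurable_backLim hev z₀).comp (by fun_prop)

lemma ae_infinite_fst_le {a : ℝ} (ha : 0 < a) :
    ∀ᵐ w ∂Measure.infinitePi (fun _ : ℕ => (volume : Measure unitInterval).prod ν),
      {k | ((w k).1 : ℝ) ≤ a}.Infinite := by
  have h : MeasurePreserving (fun (w : ℕ → unitInterval × LipFun) k => (w k).1)
      (Measure.infinitePi fun _ : ℕ => (volume : Measure unitInterval).prod ν)
      (Measure.infinitePi fun _ : ℕ => (volume : Measure unitInterval)) := by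
    refine ⟨by fun_prop, ?_⟩
    rw [Measure.infinitePi_map_pi _ (f := fun _ => Prod.fst) fun _ => measurable_fst]
    simp [Measure.map_fst_prod]
  exact h.quasiMeasurePreserving.ae (ae_infinite_le ha)

variable [IsProbabilityMeasure P] {X Y : Ω → ℝ} {δ : ℝ}

/-- The conditional law of the limit of a sequence given the limit of a thinned subsequence. -/
lemma isCondLawOn_insertLaw (hev : ∀ x : ℝ, Measurable (fun f : LipFun => f x))
    (hrec : HasRecovery ν z₀ K 𝓕 g) (H : ContractsOn c K 𝓕) (hW : AEMeasurable W P)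
    (hlaw : P.map W = Measure.infinitePi fun _ : ℕ => (volume : Measure unitInterval).prod ν)
    (hX : ∀ᵐ ω ∂P, X ω = keptLim z₀ (Real.exp (-δ)) (W ω))
    (hY : ∀ᵐ ω ∂P, Y ω = fullLim z₀ (W ω)) :
    IsCondLawOn P Y X K (fun z => insertLaw ν z₀ δ (g z)) := by
  have hk := measurable_keptLim (z₀ := z₀) hev (Real.exp (-δ))
  have hf := measurable_fullLim (z₀ := z₀) hev
  have := isProbabilityMeasure_limitLaw (ν := ν) (z₀ := z₀) hev
  have hF : Measurable fun p : ℝ × (ℕ → unitInterval × LipFun) =>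
      backLim z₀ (insertSeq (Real.exp (-δ)) (g p.1) p.2) :=
    (measurable_backLim hev z₀).comp ((measurable_insertSeq _).comp
      (((measurable_pi_lambda _ hrec.measurable).comp measurable_fst).prodMk measurable_snd))
  refine isCondLawOn_of_map_eq (limitLaw ν z₀)
    (ae_mem_limitLaw hev H hrec.ae_mem)
    (Measure.infinitePi fun _ : ℕ => (volume : Measure unitInterval).prod ν)
    hF (fun z _ => rfl) ((hk.comp_aemeasurable hW).congr (hX.mono fun _ h => h.symm))
    ((hf.comp_aemeasurable hW).congr (hY.mono fun _ h => h.symm)) ?_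
  have hXY : (fun ω => (X ω, Y ω)) =ᵐ[P]
      fun ω => (keptLim z₀ (Real.exp (-δ)) (W ω), fullLim z₀ (W ω)) := by
    filter_upwards [hX, hY] with ω h1 h2
    rw [h1, h2]
  rw [Measure.map_congr hXY]
  refine map_prodMk_eq_of_representation hev hW hlaw (measurable_labelledInsert _)
    (map_labelledInsert ν (Real.exp (-δ))) hk hf hF ?_
  filter_upwards [Measure.quasiMeasurePreserving_fst.ae (ae_forall_infinitePi ν hrec.ae_mem),
    Measure.quasiMeasurePreserving_snd.ae (ae_forall_snd_mem hrec.ae_mem),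
    Measure.quasiMeasurePreserving_snd.ae (ae_infinite_fst_le (Real.exp_pos (-δ)))]
    with p h1 h2 h3
  refine ⟨?_, ?_⟩
  · refine (H.backLim_deleteSeq z₀ (insertSeq_mem h1 h2) h3).trans ?_
    congr 1
    funext j
    exact insertSeq_nth p.1 h3 j
  -- Here recovery enters: the sequence `χ` is a function of its limit.
  · rw [hrec.eq_of_backLim H h1]
    rfl

/-- The conditional law of the limit of a thinned subsequence given the limit of the sequence. -/
lemma isCondLawOn_deleteLaw (hev : ∀ x : ℝ, Measurable (fun f : LipFun => f x))
    (hrec : HasRecovery ν z₀ K 𝓕 g) (H : ContractsOn c K 𝓕) (hW : AEMeasurable W P)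
    (hlaw : P.map W = Measure.infinitePi fun _ : ℕ => (volume : Measure unitInterval).prod ν)
    (hX : ∀ᵐ ω ∂P, X ω = keptLim z₀ (Real.exp (-δ)) (W ω))
    (hY : ∀ᵐ ω ∂P, Y ω = fullLim z₀ (W ω)) :
    IsCondLawOn P X Y K (fun z => deleteLaw z₀ δ (g z)) := by
  have hk := measurable_keptLim (z₀ := z₀) hev (Real.exp (-δ))
  have hf := measurable_fullLim (z₀ := z₀) hev
  have := isProbabilityMeasure_limitLaw (ν := ν) (z₀ := z₀) hev
  have hF : Measurable fun p : ℝ × (ℕ → unitInterval × LipFun) =>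
      backLim z₀ (deleteSeq (Real.exp (-δ)) (g p.1) fun k => (p.2 k).1) :=
    (measurable_backLim hev z₀).comp ((measurable_deleteSeq _).comp
      (((measurable_pi_lambda _ hrec.measurable).comp measurable_fst).prodMk (by fun_prop)))
  refine isCondLawOn_of_map_eq (limitLaw ν z₀)
    (ae_mem_limitLaw hev H hrec.ae_mem)
    (Measure.infinitePi fun _ : ℕ => (volume : Measure unitInterval).prod ν)
    hF (fun z _ => ?_) ((hf.comp_aemeasurable hW).congr (hY.mono fun _ h => h.symm))
    ((hk.comp_aemeasurable hW).congr (hX.mono fun _ h => h.symm)) ?_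
  · have h := Measure.infinitePi_map_pi
      (fun _ : ℕ => (volume : Measure unitInterval).prod ν) (f := fun _ => Prod.fst)
      fun _ => measurable_fst
    simp only [Measure.map_fst_prod, measure_univ, one_smul] at h
    rw [deleteLaw, ← h, Measure.map_map (measurable_backLim_deleteSeq hev z₀ _ _) (by fun_prop)]
    rfl
  have hXY : (fun ω => (Y ω, X ω)) =ᵐ[P]
      fun ω => (fullLim z₀ (W ω), keptLim z₀ (Real.exp (-δ)) (W ω)) := by
    filter_upwards [hX, hY] with ω h1 h2
    rw [h1, h2]
  rw [Measure.map_congr hXY]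
  -- At level `1` every position is old, so the construction just attaches independent labels to
  -- `χ`.
  refine map_prodMk_eq_of_representation hev hW hlaw (measurable_labelledInsert _)
    (map_labelledInsert ν 1) hf hk hF ?_
  filter_upwards [Measure.quasiMeasurePreserving_fst.ae (ae_forall_infinitePi ν hrec.ae_mem)]
    with p h1
  have hins : insertSeq 1 p.1 p.2 = p.1 := funext fun k =>
    insertSeq_eq_of_forall_le (n := k + 1) p.1 (fun i _ => (p.2 i).1.2.2) k.lt_succ_self
  refine ⟨?_, ?_⟩
  · simp only [fullLim, labelledInsert, hins]
  · rw [hrec.eq_of_backLim H h1]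
    simp only [keptLim, labelledInsert, hins]

end CondLaw

/-! ### Combinatorics of occupied cells -/

/-- The number of elements of `s` below `j`. -/
def rankIn (s : Finset ℕ) (j : ℕ) : ℕ := (s.filter (· < j)).card

/-- The least strict upper bound of `s`. -/
def strictSup (s : Finset ℕ) : ℕ := s.sup (· + 1)

lemma lt_strictSup {s : Finset ℕ} {j : ℕ} (hj : j ∈ s) : j < strictSup s :=
  Finset.le_sup (f := (· + 1)) hj

lemma prod_rankIn {β : Type*} [CommMonoid β] (s : Finset ℕ) (f : ℕ → β) :
    ∏ j ∈ s, f (rankIn s j) = ∏ l ∈ Finset.range s.card, f l := by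
  induction s using Finset.induction_on_max with
  | empty => simp
  | insert a s ha ih =>
    have has : a ∉ s := fun h => lt_irrefl a (ha a h)
    have h1 : ∀ j ∈ s, rankIn (insert a s) j = rankIn s j := fun j hj => by
      rw [rankIn, rankIn, Finset.filter_insert, if_neg (ha j hj).not_gt]
    have h2 : rankIn (insert a s) a = s.card := by
      rw [rankIn, Finset.filter_insert, if_neg (lt_irrefl a), Finset.filter_true_of_mem ha]
    rw [Finset.prod_insert has, h2, Finset.prod_congr rfl fun j hj => by rw [h1 j hj], ih,
      Finset.card_insert_of_notMem has, Finset.prod_range_succ, mul_comm]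

/-- The points numbered `k`, in the cells `c k` and with marks `x k`, occupy exactly the cells in
`s` below `strictSup s`, each of them once, and the marks belong to the sets `B`. -/
def CellPattern {M : Type*} (c : ℕ → ℕ) (x : ℕ → M) (s : Finset ℕ) (B : ℕ → Set M) : Prop :=
  ∀ j < strictSup s, {k | c k = j ∧ x k ∈ B (rankIn s j)}.encard = (if j ∈ s then 1 else 0 : ℕ) ∧
    {k | c k = j ∧ x k ∈ (B (rankIn s j))ᶜ}.encard = 0

namespace CellPattern

variable {M : Type*} {c : ℕ → ℕ} {x : ℕ → M} {s : Finset ℕ}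

lemma mem_of_lt (h : CellPattern c x s fun _ => univ) {k : ℕ} (hk : c k < strictSup s) :
    c k ∈ s := by
  by_contra hs
  have := (h _ hk).1
  rw [if_neg hs, Nat.cast_zero, encard_eq_zero] at this
  exact (this.subset (⟨rfl, mem_univ _⟩ : k ∈ {i | c i = c k ∧ x i ∈ univ}) :)

lemma eq_of_eq (h : CellPattern c x s fun _ => univ) {k k' : ℕ} (hk : c k < strictSup s)
    (hkk : c k' = c k) : k' = k := by
  have := (h _ hk).1
  rw [if_pos (h.mem_of_lt hk), Nat.cast_one, encard_eq_one] at this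
  obtain ⟨a, ha⟩ := this
  have h1 : k ∈ ({a} : Set ℕ) := by rw [← ha]; exact ⟨rfl, mem_univ _⟩
  have h2 : k' ∈ ({a} : Set ℕ) := by rw [← ha]; exact ⟨hkk, mem_univ _⟩
  rw [mem_singleton_iff] at h1 h2
  rw [h1, h2]

lemma exists_eq (h : CellPattern c x s fun _ => univ) {j : ℕ} (hj : j ∈ s) : ∃ k, c k = j := by
  have := (h _ (lt_strictSup hj)).1
  rw [if_pos hj, Nat.cast_one, encard_eq_one] at this
  obtain ⟨a, ha⟩ := this
  have : a ∈ {k | c k = j ∧ x k ∈ univ} := by rw [ha]; exact mem_singleton a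
  exact ⟨a, this.1⟩

/-- The indices whose cells lie below `strictSup s` are in bijection with `s`, and by monotonicity
they form an initial segment of `ℕ`, so it is the one of length `s.card`. -/
lemma lt_strictSup_iff (hc : Monotone c) (h : CellPattern c x s fun _ => univ) (k : ℕ) :
    c k < strictSup s ↔ k < s.card := by
  classical
  have hbij : BijOn c {k | c k < strictSup s} s :=
    ⟨fun k hk => h.mem_of_lt hk, fun k hk k' hk' hkk => h.eq_of_eq hk' hkk, fun j hj => by
      obtain ⟨k, rfl⟩ := h.exists_eq hj
      exact ⟨k, lt_strictSup hj, rfl⟩⟩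
  have hfin : {k | c k < strictSup s}.Finite := hbij.finite_iff_finite.2 s.finite_toSet
  have hcard : hfin.toFinset.card = s.card := by
    rw [← ncard_eq_toFinset_card _ hfin, hbij.ncard_eq, ncard_coe_finset]
  have hlow : ∀ i k, i ≤ k → c k < strictSup s → c i < strictSup s := fun i k hik hk =>
    (hc hik).trans_lt hk
  constructor
  · intro hk
    have : Finset.range (k + 1) ⊆ hfin.toFinset := fun i hi => by
      rw [Finite.mem_toFinset]
      exact hlow i k (Nat.lt_succ_iff.1 (Finset.mem_range.1 hi)) hk
    have := Finset.card_le_card this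
    rw [Finset.card_range, hcard] at this
    exact this
  · intro hk
    by_contra hnot
    have : hfin.toFinset ⊆ Finset.range k := fun i hi => by
      rw [Finite.mem_toFinset] at hi
      rw [Finset.mem_range]
      by_contra hik
      exact hnot (hlow k i (not_lt.1 hik) hi)
    have := Finset.card_le_card this
    rw [Finset.card_range, hcard] at this
    omega

lemma eq_image (hc : Monotone c) (h : CellPattern c x s fun _ => univ) :
    s = (Finset.range s.card).image c := by
  ext j
  simp only [Finset.mem_image, Finset.mem_range]
  constructor
  · intro hj
    obtain ⟨k, rfl⟩ := h.exists_eq hj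
    exact ⟨k, (h.lt_strictSup_iff hc k).1 (lt_strictSup hj), rfl⟩
  · rintro ⟨k, hk, rfl⟩
    exact h.mem_of_lt ((h.lt_strictSup_iff hc k).2 hk)

/-- A pattern is the set of cells of the first `s.card` points, so only its size is free. Hence
patterns of equal size exclude each other. -/
lemma unique (hc : Monotone c) {s' : Finset ℕ} (h : CellPattern c x s fun _ => univ)
    (h' : CellPattern c x s' fun _ => univ) (hcard : s.card = s'.card) : s = s' := by
  rw [h.eq_image hc, h'.eq_image hc, hcard]

lemma rankIn_apply (hc : Monotone c) (h : CellPattern c x s fun _ => univ) {k : ℕ}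
    (hk : k < s.card) : rankIn s (c k) = k := by
  have hinj : ∀ i j, j < s.card → c i = c j → i = j := fun i j hj hij =>
    h.eq_of_eq ((h.lt_strictSup_iff hc j).2 hj) hij
  have : s.filter (· < c k) = (Finset.range k).image c := by
    ext j
    simp only [Finset.mem_filter, Finset.mem_image, Finset.mem_range]
    constructor
    · rintro ⟨hj, hlt⟩
      obtain ⟨i, rfl⟩ := h.exists_eq hj
      exact ⟨i, hc.reflect_lt hlt, rfl⟩
    · rintro ⟨i, hi, rfl⟩
      exact ⟨h.mem_of_lt ((h.lt_strictSup_iff hc i).2 (hi.trans hk)),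
        lt_of_le_of_ne (hc hi.le) fun he => hi.ne (hinj i k hk he)⟩
  rw [rankIn, this, Finset.card_image_of_injOn, Finset.card_range]
  intro i hi j hj hij
  exact hinj i j ((Finset.mem_range.1 hj).trans hk) hij

/-- For a given pattern of occupied cells, the events on the marks are those on the first marks. -/
lemma iff_forall_mem (hc : Monotone c) (h : CellPattern c x s fun _ => univ) (B : ℕ → Set M) :
    CellPattern c x s B ↔ ∀ l < s.card, x l ∈ B l := by
  constructor
  · intro hB l hl
    have hlt := (h.lt_strictSup_iff hc l).2 hl
    have := (hB _ hlt).2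
    rw [encard_eq_zero, h.rankIn_apply hc hl] at this
    by_contra hx
    exact (this.subset (⟨rfl, hx⟩ : l ∈ {i | c i = c l ∧ x i ∈ (B l)ᶜ}) :)
  · intro hB j hj
    by_cases hjs : j ∈ s
    · obtain ⟨k, rfl⟩ := h.exists_eq hjs
      have hk := (h.lt_strictSup_iff hc k).1 hj
      rw [if_pos hjs, h.rankIn_apply hc hk, Nat.cast_one, encard_eq_one, encard_eq_zero]
      refine ⟨⟨k, ?_⟩, ?_⟩
      · ext i
        simp only [mem_ofPred_eq, mem_singleton_iff]
        refine ⟨fun hi => h.eq_of_eq hj hi.1, ?_⟩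
        rintro rfl
        exact ⟨rfl, hB _ hk⟩
      · ext i
        simp only [mem_ofPred_eq, mem_empty_iff_false, iff_false]
        rintro ⟨h1, h2⟩
        rw [h.eq_of_eq hj h1] at h2
        exact h2 (hB _ hk)
    · have hno : ∀ k, c k ≠ j := by
        rintro k rfl
        exact hjs (h.mem_of_lt hj)
      simp [hjs, hno]

/-- The strict step at `k = n - 1` keeps point `n` out of the last cell of the pattern. -/
lemma of_strictMono (x : ℕ → M) (hc : Monotone c) {n : ℕ} (hn : ∀ k < n, c k < c (k + 1)) :
    ((Finset.range n).image c).card = n ∧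
      CellPattern c x ((Finset.range n).image c) fun _ => univ := by
  have hlt : ∀ i k, i < k → i < n → c i < c k := fun i k hik hi =>
    (hn i hi).trans_le (hc hik)
  have hinj : ∀ i k, i < n → c k = c i → k = i := fun i k hi hik => by
    rcases lt_trichotomy i k with h | h | h
    · exact absurd hik (hlt i k h hi).ne'
    · exact h.symm
    · exact absurd hik (hlt k i h (h.trans hi)).ne
  refine ⟨?_, fun j hj => ⟨?_, by simp⟩⟩
  · rw [Finset.card_image_of_injOn, Finset.card_range]
    intro i hi j hj hij
    exact hinj j i (Finset.mem_range.1 hj) hij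
  · have hsup : ∀ k, c k = j → k < n := fun k hk => by
      by_contra hnk
      rw [strictSup, Finset.lt_sup_iff] at hj
      obtain ⟨a, ha, hja⟩ := hj
      obtain ⟨i, hi, rfl⟩ := Finset.mem_image.1 ha
      have := hlt i k ((Finset.mem_range.1 hi).trans_le (not_lt.1 hnk)) (Finset.mem_range.1 hi)
      omega
    by_cases hjs : j ∈ (Finset.range n).image c
    · obtain ⟨i, hi, rfl⟩ := Finset.mem_image.1 hjs
      rw [if_pos hjs, Nat.cast_one, encard_eq_one]
      refine ⟨i, ?_⟩
      ext k
      simp only [mem_univ, and_true, mem_ofPred_eq, mem_singleton_iff]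
      exact ⟨hinj i k (Finset.mem_range.1 hi), fun h => h ▸ rfl⟩
    · rw [if_neg hjs, Nat.cast_zero, encard_eq_zero]
      ext k
      simp only [mem_univ, and_true, mem_ofPred_eq, mem_empty_iff_false, iff_false]
      intro hk
      exact hjs (Finset.mem_image.2 ⟨k, Finset.mem_range.2 (hsup k hk), hk⟩)

end CellPattern

/-! ### Enumeration in the order of times -/

/-- A locally finite set of reals which is bounded below and unbounded above is the range of a
strictly increasing sequence that tends to infinity. -/
lemma exists_strictMono_range_eq {A : Set ℝ} (hfin : ∀ b, (A ∩ Iio b).Finite)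
    (hunb : ∀ b, ∃ a ∈ A, b ≤ a) :
    ∃ τ : ℕ → ℝ, StrictMono τ ∧ range τ = A ∧ Tendsto τ atTop atTop := by
  classical
  -- A locally finite linear order with a least and without a greatest element is isomorphic to `ℕ`;
  -- the instances below establish these properties of `A`.
  let _ : LocallyFiniteOrder A := LocallyFiniteOrder.ofFiniteIcc fun a b => by
    refine Finite.of_finite_image (f := Subtype.val) ?_ Subtype.val_injective.injOn
    refine (hfin (b + 1)).subset ?_
    rintro _ ⟨x, hx, rfl⟩
    exact ⟨x.2, lt_of_le_of_lt (Subtype.coe_le_coe.2 hx.2) (lt_add_one _)⟩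
  obtain ⟨a₀, ha₀, -⟩ := hunb 0
  have : Nonempty A := ⟨⟨a₀, ha₀⟩⟩
  have : NoMaxOrder A := ⟨fun a => by
    obtain ⟨b, hb, hab⟩ := hunb (a + 1)
    exact ⟨⟨b, hb⟩, Subtype.coe_lt_coe.1 (lt_of_lt_of_le (lt_add_one (a : ℝ)) hab)⟩⟩
  obtain ⟨m, hm⟩ := (hfin (a₀ + 1)).exists_minimal ⟨a₀, ha₀, lt_add_one a₀⟩
  let _ : OrderBot A :=
    { bot := ⟨m, hm.prop.1⟩
      bot_le := fun a => by
        change m ≤ a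
        rcases lt_or_ge (a : ℝ) m with h | h
        · exact hm.le_of_le ⟨a.2, h.trans hm.prop.2⟩ h.le
        · exact h }
  let _ : SuccOrder A := LinearLocallyFiniteOrder.succOrder A
  let _ : PredOrder A := LinearLocallyFiniteOrder.predOrder A
  let e : A ≃o ℕ := orderIsoNatOfLinearSuccPredArch
  refine ⟨fun k => (e.symm k : ℝ), fun i j hij => ?_, ?_, ?_⟩
  · exact Subtype.coe_lt_coe.2 (e.symm.strictMono hij)
  · ext a
    constructor
    · rintro ⟨k, rfl⟩
      exact (e.symm k).2
    · intro ha
      exact ⟨e ⟨a, ha⟩, by simp⟩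
  · refine tendsto_atTop_atTop_of_monotone
      (fun i j hij => Subtype.coe_le_coe.2 (e.symm.monotone hij)) fun b => ?_
    obtain ⟨a, ha, hab⟩ := hunb b
    exact ⟨e ⟨a, ha⟩, by simpa using hab⟩

/-- Points with distinct, nonnegative, locally finite and unbounded times can be enumerated in the
order of their times. -/
lemma exists_enumeration {E : Type*} {S : Set E} {T : E → ℝ} (hinj : InjOn T S)
    (hfin : ∀ b, (S ∩ {e | T e < b}).Finite) (hunb : ∀ b, ∃ e ∈ S, b ≤ T e) :
    ∃ p : ℕ → E, StrictMono (fun k => T (p k)) ∧ range p = S ∧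
      Tendsto (fun k => T (p k)) atTop atTop := by
  obtain ⟨τ, hτ, hr, ht⟩ := exists_strictMono_range_eq (A := T '' S) (fun b => by
    refine ((hfin b).image T).subset ?_
    rintro _ ⟨⟨e, he, rfl⟩, hb⟩
    exact ⟨e, ⟨he, hb⟩, rfl⟩) (fun b => by
      obtain ⟨e, he, hb⟩ := hunb b
      exact ⟨T e, ⟨e, he, rfl⟩, hb⟩)
  have hmem : ∀ k, ∃ e ∈ S, T e = τ k := fun k => by
    have : τ k ∈ T '' S := hr ▸ mem_range_self k
    exact this
  choose p hpS hpT using hmem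
  refine ⟨p, by simpa only [hpT] using hτ, ?_, by simpa only [hpT] using ht⟩
  ext e
  constructor
  · rintro ⟨k, rfl⟩
    exact hpS k
  · intro he
    obtain ⟨k, hk⟩ : T e ∈ range τ := hr ▸ ⟨e, he, rfl⟩
    exact ⟨k, hinj (hpS k) he (by rw [hpT, hk])⟩

/-! ### Counts of a Poisson process -/

section Counts

variable {Ω E : Type*} [MeasurableSpace Ω] [MeasurableSpace E] {Pts : Ω → Set E} {Λ : Measure E}
  {P : Measure Ω}

lemma IsPoissonProcess.measurableSet_count (h : IsPoissonProcess Pts Λ P) {B : Set E}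
    (hB : MeasurableSet B) (n : ℕ∞) : MeasurableSet {ω | (Pts ω ∩ B).encard = n} :=
  h.measurable_count B hB (measurableSet_singleton n)

lemma IsPoissonProcess.measure_count_eq_zero (h : IsPoissonProcess Pts Λ P) {B : Set E}
    (hB : MeasurableSet B) {x : ℝ} (hx : 0 ≤ x) (hΛ : Λ B = ENNReal.ofReal x) :
    P {ω | (Pts ω ∩ B).encard = 0} = ENNReal.ofReal (Real.exp (-x)) := by
  have := h.law_count B hB (by simp [hΛ]) 0
  rw [poissonMeasure_singleton, hΛ] at this
  have hc : ((ENNReal.ofReal x).toNNReal : ℝ) = x := ENNReal.toReal_ofReal hx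
  simpa [hc] using this

lemma IsPoissonProcess.measure_count_eq_one (h : IsPoissonProcess Pts Λ P) {B : Set E}
    (hB : MeasurableSet B) {x : ℝ} (hx : 0 ≤ x) (hΛ : Λ B = ENNReal.ofReal x) :
    P {ω | (Pts ω ∩ B).encard = 1} = ENNReal.ofReal (Real.exp (-x) * x) := by
  have := h.law_count B hB (by simp [hΛ]) 1
  rw [poissonMeasure_singleton, hΛ] at this
  have hc : ((ENNReal.ofReal x).toNNReal : ℝ) = x := ENNReal.toReal_ofReal hx
  simpa [hc] using this

/-- `1 - e^{-x} (1 + x) ≤ 1 - (1 - x) (1 + x) = x ^ 2`. The quadratic order makes double occupancy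
negligible on fine grids. -/
lemma IsPoissonProcess.measure_not_count_le_one [IsProbabilityMeasure P]
    (h : IsPoissonProcess Pts Λ P) {B : Set E}
    (hB : MeasurableSet B) {x : ℝ} (hx : 0 ≤ x) (hΛ : Λ B = ENNReal.ofReal x) :
    P {ω | ¬ (Pts ω ∩ B).encard ≤ 1} ≤ ENNReal.ofReal (x ^ 2) := by
  have h0 := h.measurableSet_count hB 0
  have h1 := h.measurableSet_count hB 1
  have hset : {ω | ¬ (Pts ω ∩ B).encard ≤ 1} =
      ({ω | (Pts ω ∩ B).encard = 0} ∪ {ω | (Pts ω ∩ B).encard = 1})ᶜ := by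
    ext ω
    simp only [mem_ofPred_eq, mem_compl_iff, mem_union, Order.le_one_iff]
  have hdisj : Disjoint {ω | (Pts ω ∩ B).encard = 0} {ω | (Pts ω ∩ B).encard = 1} := by
    rw [Set.disjoint_left]
    intro ω (hω : _ = _) (hω' : _ = _)
    rw [hω] at hω'
    exact zero_ne_one hω'
  rw [hset, prob_compl_eq_one_sub (h0.union h1), measure_union hdisj h1,
    h.measure_count_eq_zero hB hx hΛ, h.measure_count_eq_one hB hx hΛ,
    ← ENNReal.ofReal_add (Real.exp_pos _).le (by positivity), ← ENNReal.ofReal_one,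
    ← ENNReal.ofReal_sub _ (by positivity)]
  refine ENNReal.ofReal_le_ofReal ?_
  nlinarith [Real.add_one_le_exp (-x), Real.exp_pos (-x)]

/-- Independence of the counts for finitely many disjoint sets. -/
lemma IsPoissonProcess.measure_forall_count (h : IsPoissonProcess Pts Λ P) {ι : Type*} [Fintype ι]
    {B : ι → Set E} (hB : ∀ i, MeasurableSet (B i))
    (hd : Pairwise fun i j => Disjoint (B i) (B j)) (n : ι → ℕ∞) :
    P {ω | ∀ i, (Pts ω ∩ B i).encard = n i} = ∏ i, P {ω | (Pts ω ∩ B i).encard = n i} := by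
  let e := (Fintype.equivFin ι).symm
  have hi := h.indep_count _ (fun i => B (e i)) (fun i => hB _) fun i j hij =>
    hd fun he => hij (e.injective he)
  have := hi.measure_inter_preimage_eq_mul Finset.univ (sets := fun i => {n (e i)})
    fun i _ => measurableSet_singleton _
  rw [← e.prod_comp]
  refine Eq.trans ?_ this
  congr 1
  ext ω
  simp only [mem_ofPred_eq, Finset.mem_univ, iInter_true, mem_iInter, mem_preimage,
    mem_singleton_iff]
  exact ⟨fun hω i => hω _, fun hω i => by simpa using hω (e.symm i)⟩

end Counts

/-! ### Marked Poisson processes on time grids -/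

section Marks

variable {Ω E M : Type*} [MeasurableSpace Ω] [MeasurableSpace E] [MeasurableSpace M]

/-- The points of `R` with time in `[a, b)` and mark in `B`. -/
def timeCell (T : E → ℝ) (m : E → M) (R : Set E) (a b : ℝ) (B : Set M) : Set E :=
  {e | e ∈ R ∧ T e ∈ Ico a b ∧ m e ∈ B}

/-- On the region `R`, the intensity `Λ` is that of a homogeneous Poisson process on `[0, ∞)` with
rate `r` and independent marks with law `ρ`. -/
structure IsMarkedRegion (Λ : Measure E) (T : E → ℝ) (m : E → M) (R : Set E) (r : ℝ)
    (ρ : Measure M) : Prop where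
  measurable_time : Measurable T
  measurable_mark : Measurable m
  measurableSet : MeasurableSet R
  pos : 0 < r
  measure_cell : ∀ a b : ℝ, 0 ≤ a → a ≤ b → ∀ B, MeasurableSet B →
    Λ (timeCell T m R a b B) = ENNReal.ofReal (r * (b - a)) * ρ B
  measure_neg : Λ {e | e ∈ R ∧ T e < 0} = 0

/-- Cell number `j` of the partition of time into intervals of length `1 / (d + 1)`. -/
abbrev gridCell (T : E → ℝ) (m : E → M) (R : Set E) (d j : ℕ) (B : Set M) : Set E :=
  timeCell T m R (j / (d + 1)) ((j + 1) / (d + 1)) B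

/-- Exactly the cells with numbers in `s` are occupied among those below `strictSup s`, each by one
point, and the marks of these points belong to the sets `B`. -/
def gridEvent (Pts : Ω → Set E) (T : E → ℝ) (m : E → M) (R : Set E) (d : ℕ) (s : Finset ℕ)
    (B : ℕ → Set M) : Set Ω :=
  {ω | ∀ j < strictSup s,
    (Pts ω ∩ gridCell T m R d j (B (rankIn s j))).encard = (if j ∈ s then 1 else 0 : ℕ) ∧
      (Pts ω ∩ gridCell T m R d j (B (rankIn s j))ᶜ).encard = 0}

/-- The points of `R` have nonnegative, unbounded times, and for each bounded time interval some
partition separates them. -/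
def goodEvent (Pts : Ω → Set E) (T : E → ℝ) (m : E → M) (R : Set E) : Set Ω :=
  {ω | (Pts ω ∩ {e | e ∈ R ∧ T e < 0}).encard = 0 ∧
    (∀ b : ℕ, (Pts ω ∩ {e | e ∈ R ∧ (b : ℝ) ≤ T e}).encard ≠ 0) ∧
    ∀ b : ℕ, ∃ d : ℕ, ∀ j < b * (d + 1), (Pts ω ∩ gridCell T m R d j univ).encard ≤ 1}

variable {Pts : Ω → Set E} {Λ : Measure E} {P : Measure Ω} {T : E → ℝ} {m : E → M} {R : Set E}
  {r : ℝ} {ρ : Measure M}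

namespace IsMarkedRegion

lemma measurableSet_timeCell (hR : IsMarkedRegion Λ T m R r ρ) (a b : ℝ) {B : Set M}
    (hB : MeasurableSet B) : MeasurableSet (timeCell T m R a b B) :=
  hR.measurableSet.inter ((hR.measurable_time measurableSet_Ico).inter (hR.measurable_mark hB))

lemma measurableSet_gridEvent (hR : IsMarkedRegion Λ T m R r ρ) (hPts : IsPoissonProcess Pts Λ P)
    (d : ℕ) (s : Finset ℕ) {B : ℕ → Set M} (hB : ∀ i, MeasurableSet (B i)) :
    MeasurableSet (gridEvent Pts T m R d s B) := by
  simp only [gridEvent, ofPred_forall]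
  exact .iInter fun j => .iInter fun _ =>
    (hPts.measurableSet_count (hR.measurableSet_timeCell _ _ (hB _)) _).inter
      (hPts.measurableSet_count (hR.measurableSet_timeCell _ _ (hB _).compl) _)

/-- The event is a countable combination of events on counts, the only measurable data of the
process. -/
lemma measurableSet_goodEvent (hR : IsMarkedRegion Λ T m R r ρ) (hPts : IsPoissonProcess Pts Λ P) :
    MeasurableSet (goodEvent Pts T m R) := by
  refine (hPts.measurableSet_count (hR.measurableSet.inter
    (hR.measurable_time measurableSet_Iio)) 0).inter (MeasurableSet.inter ?_ ?_)
  · change MeasurableSet {ω | ∀ b : ℕ, (Pts ω ∩ {e | e ∈ R ∧ (b : ℝ) ≤ T e}).encard ≠ 0}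
    simp only [ofPred_forall]
    exact .iInter fun b => (hPts.measurableSet_count (hR.measurableSet.inter
      (hR.measurable_time measurableSet_Ici)) 0).compl
  · change MeasurableSet {ω | ∀ b : ℕ, ∃ d : ℕ, ∀ j < b * (d + 1),
      (Pts ω ∩ gridCell T m R d j univ).encard ≤ 1}
    simp only [ofPred_forall, ofPred_exists]
    exact .iInter fun b => .iUnion fun d => .iInter fun j => .iInter fun _ =>
      hPts.measurable_count _ (hR.measurableSet_timeCell _ _ .univ)
        (MeasurableSet.of_discrete (s := Iic 1))

lemma measure_gridCell [IsProbabilityMeasure ρ] (hR : IsMarkedRegion Λ T m R r ρ) (d j : ℕ)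
    {B : Set M} (hB : MeasurableSet B) :
    Λ (gridCell T m R d j B) = ENNReal.ofReal (r / (d + 1) * ρ.real B) := by
  have hr := hR.pos
  rw [hR.measure_cell _ _ (by positivity) (by gcongr; linarith) B hB,
    ENNReal.ofReal_mul (by positivity : 0 ≤ r / (d + 1)), ofReal_measureReal]
  congr 2
  field_simp
  ring

/-- The probability of a pattern of occupied cells with conditions on the marks. -/
lemma measure_gridEvent [IsProbabilityMeasure ρ] (hR : IsMarkedRegion Λ T m R r ρ)
    (hPts : IsPoissonProcess Pts Λ P) (d : ℕ) (s : Finset ℕ) {B : ℕ → Set M}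
    (hB : ∀ i, MeasurableSet (B i)) :
    P (gridEvent Pts T m R d s B) = (∏ l ∈ Finset.range s.card, ρ (B l)) *
      ∏ j ∈ Finset.range (strictSup s), if j ∈ s then
        ENNReal.ofReal (r / (d + 1) * Real.exp (-(r / (d + 1))))
      else ENNReal.ofReal (Real.exp (-(r / (d + 1)))) := by
  have hr := hR.pos
  -- Each cell is split by the mark into the part in `B` and the part in its complement; all these
  -- sets are disjoint, so their counts are independent.
  let C : Fin (strictSup s) × Bool → Set E := fun q => gridCell T m R d q.1
    (_root_.cond q.2 (B (rankIn s q.1)) (B (rankIn s q.1))ᶜ)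
  let n : Fin (strictSup s) × Bool → ℕ∞ := fun q => _root_.cond q.2 (if (q.1 : ℕ) ∈ s then 1 else 0 : ℕ) 0
  have hC : ∀ q, MeasurableSet (C q) := by
    rintro ⟨j, _ | _⟩
    exacts [hR.measurableSet_timeCell _ _ (hB _).compl, hR.measurableSet_timeCell _ _ (hB _)]
  have hd0 : (0 : ℝ) < d + 1 := by positivity
  have hlt : ∀ {i j : ℕ} {A A' : Set M}, i < j →
      Disjoint (gridCell T m R d i A) (gridCell T m R d j A') := by
    intro i j A A' hij
    rw [Set.disjoint_left]
    rintro e ⟨-, h1, -⟩ ⟨-, h2, -⟩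
    have h3 : ((i : ℝ) + 1) / (d + 1) ≤ j / (d + 1) := by
      gcongr
      exact_mod_cast hij
    exact absurd (h1.2.trans_le (h3.trans h2.1)) (lt_irrefl _)
  have hdisj : Pairwise fun q q' => Disjoint (C q) (C q') := by
    rintro ⟨i, b⟩ ⟨j, b'⟩ hne
    rcases lt_trichotomy (i : ℕ) j with h | h | h
    · exact hlt h
    · have hij : i = j := Fin.ext h
      subst hij
      have hb : b ≠ b' := fun h => hne (by rw [h])
      rw [Set.disjoint_left]
      rintro e ⟨-, -, h1⟩ ⟨-, -, h2⟩
      cases b <;> cases b' <;> simp_all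
    · exact (hlt h).symm
  have hset : gridEvent Pts T m R d s B = {ω | ∀ q, (Pts ω ∩ C q).encard = n q} := by
    ext ω
    simp only [gridEvent, mem_ofPred_eq, Prod.forall, Bool.forall_bool, Fin.forall_iff, C, n, _root_.cond]
    exact forall₂_congr fun j hj => and_comm
  rw [hset, hPts.measure_forall_count hC hdisj n, Fintype.prod_prod_type]
  simp only [Fintype.prod_bool]
  rw [Finset.prod_fin_eq_prod_range, ← prod_rankIn]
  have hsub : s ⊆ Finset.range (strictSup s) := fun j hj => Finset.mem_range.2 (lt_strictSup hj)
  have hprod : ∏ j ∈ s, ρ (B (rankIn s j)) =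
      ∏ j ∈ Finset.range (strictSup s), if j ∈ s then ρ (B (rankIn s j)) else 1 := by
    rw [Finset.prod_ite_mem, Finset.inter_eq_right.2 hsub]
  rw [hprod, ← Finset.prod_mul_distrib]
  refine Finset.prod_congr rfl fun j hj => ?_
  rw [dif_pos (Finset.mem_range.1 hj)]
  have h0 : (0 : ℝ) ≤ r / (d + 1) := by positivity
  have hx := hR.measure_gridCell d j (hB (rankIn s j))
  have hy := hR.measure_gridCell d j (hB (rankIn s j)).compl
  have hx0 : 0 ≤ r / (d + 1) * ρ.real (B (rankIn s j)) := mul_nonneg h0 measureReal_nonneg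
  have hy0 : 0 ≤ r / (d + 1) * ρ.real (B (rankIn s j))ᶜ := mul_nonneg h0 measureReal_nonneg
  -- The exponentials of the two parts combine to one that does not involve `B`. Only an occupied
  -- cell contributes a factor `ρ (B _)`.
  have hexp : Real.exp (-(r / (d + 1) * ρ.real (B (rankIn s j)))) *
      Real.exp (-(r / (d + 1) * ρ.real (B (rankIn s j))ᶜ)) = Real.exp (-(r / (d + 1))) := by
    rw [← Real.exp_add, probReal_compl_eq_one_sub (hB _)]
    congr 1
    ring
  have hP0 := hPts.measure_count_eq_zero (hR.measurableSet_timeCell _ _ (hB _).compl) hy0 hy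
  simp only [C, n, _root_.cond]
  rw [hP0]
  split_ifs with hjs
  · rw [Nat.cast_one, hPts.measure_count_eq_one (hR.measurableSet_timeCell _ _ (hB _)) hx0 hx,
      ← ENNReal.ofReal_mul (by positivity), ← hexp, ← ofReal_measureReal (μ := ρ),
      ← ENNReal.ofReal_mul measureReal_nonneg]
    congr 1
    ring
  · rw [Nat.cast_zero, hPts.measure_count_eq_zero (hR.measurableSet_timeCell _ _ (hB _)) hx0 hx,
      ← ENNReal.ofReal_mul (by positivity), hexp, one_mul]

end IsMarkedRegion

end Marks

/-! ### The marks in the order of times are i.i.d. -/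

section MarkedProcesses

variable {Ω E M : Type*} {Pts : Ω → Set E} {T : E → ℝ} {m : E → M} {R : Set E}

lemma mem_gridCell_iff {d j : ℕ} {B : Set M} {e : E} (he : 0 ≤ T e) :
    e ∈ gridCell T m R d j B ↔ e ∈ R ∧ ⌊T e * (d + 1)⌋₊ = j ∧ m e ∈ B := by
  have hd : (0 : ℝ) < d + 1 := by positivity
  rw [gridCell, timeCell, mem_ofPred_eq, mem_Ico, div_le_iff₀ hd, lt_div_iff₀ hd,
    Nat.floor_eq_iff (by positivity)]

lemma gridCell_encard {p : ℕ → E} {ω : Ω} (hp : StrictMono fun k => T (p k))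
    (hr : range p = Pts ω ∩ R) (h0 : ∀ k, 0 ≤ T (p k)) (d j : ℕ) (B : Set M) :
    (Pts ω ∩ gridCell T m R d j B).encard =
      {k | ⌊T (p k) * (d + 1)⌋₊ = j ∧ m (p k) ∈ B}.encard := by
  have hinj : Function.Injective p := fun i k h => hp.injective (congrArg T h)
  rw [← hinj.encard_image]
  congr 1
  ext e
  constructor
  · rintro ⟨he, hc⟩
    obtain ⟨k, rfl⟩ : e ∈ range p := hr ▸ ⟨he, hc.1⟩
    exact ⟨k, ((mem_gridCell_iff (h0 k)).1 hc).2, rfl⟩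
  · rintro ⟨k, hk, rfl⟩
    have : p k ∈ Pts ω ∩ R := hr ▸ mem_range_self k
    exact ⟨this.1, (mem_gridCell_iff (h0 k)).2 ⟨this.2, hk⟩⟩

lemma mem_gridEvent_iff {p : ℕ → E} {ω : Ω} (hp : StrictMono fun k => T (p k))
    (hr : range p = Pts ω ∩ R) (h0 : ∀ k, 0 ≤ T (p k)) (d : ℕ) (s : Finset ℕ) (B : ℕ → Set M) :
    ω ∈ gridEvent Pts T m R d s B ↔
      CellPattern (fun k => ⌊T (p k) * (d + 1)⌋₊) (fun k => m (p k)) s B := by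
  simp only [gridEvent, mem_ofPred_eq, gridCell_encard hp hr h0, CellPattern]

lemma monotone_cellIndex {p : ℕ → E} (hp : StrictMono fun k => T (p k)) (d : ℕ) :
    Monotone fun k => ⌊T (p k) * (d + 1)⌋₊ := fun i k hik =>
  Nat.floor_le_floor (mul_le_mul_of_nonneg_right (hp.monotone hik) (by positivity))

/-- Once the mesh is smaller than the gap between consecutive times, the two points lie in different
cells. -/
lemma eventually_lt_cellIndex {p : ℕ → E} (hp : StrictMono fun k => T (p k))
    (h0 : ∀ k, 0 ≤ T (p k)) (n : ℕ) :
    ∀ᶠ d : ℕ in atTop, ∀ k < n, ⌊T (p k) * (d + 1)⌋₊ < ⌊T (p (k + 1)) * (d + 1)⌋₊ := by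
  refine (eventually_all_finite (finite_lt_nat n)).2 fun k _ => ?_
  have hpos : 0 < T (p (k + 1)) - T (p k) := sub_pos.2 (hp k.lt_succ_self)
  filter_upwards [tendsto_natCast_atTop_atTop.eventually_ge_atTop (T (p (k + 1)) - T (p k))⁻¹]
    with d hd
  have h1 : 1 ≤ (T (p (k + 1)) - T (p k)) * (d + 1) := by
    have := (inv_le_iff_one_le_mul₀ hpos).1 hd
    nlinarith
  have h2 := Nat.floor_le (mul_nonneg (h0 k) (by positivity : (0 : ℝ) ≤ d + 1))
  rw [Nat.lt_iff_add_one_le, Nat.le_floor_iff (mul_nonneg (h0 (k + 1)) (by positivity))]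
  push_cast
  linarith

namespace goodEvent

variable {ω : Ω}

lemma nonneg (hω : ω ∈ goodEvent Pts T m R) {e : E} (he : e ∈ Pts ω ∩ R) : 0 ≤ T e := by
  by_contra hneg
  have := hω.1
  rw [encard_eq_zero] at this
  exact (this.subset ⟨he.1, he.2, not_le.1 hneg⟩ :)

lemma exists_partition (hω : ω ∈ goodEvent Pts T m R) (b : ℝ) :
    ∃ (d N : ℕ), (∀ j < N, (Pts ω ∩ gridCell T m R d j univ).encard ≤ 1) ∧
      ∀ e ∈ Pts ω ∩ R, T e < b → ⌊T e * (d + 1)⌋₊ < N := by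
  obtain ⟨b', hb'⟩ := exists_nat_ge b
  obtain ⟨d, hd⟩ := hω.2.2 b'
  refine ⟨d, b' * (d + 1), hd, fun e he hb => ?_⟩
  rw [Nat.floor_lt (mul_nonneg (nonneg hω he) (by positivity))]
  push_cast
  exact mul_lt_mul_of_pos_right (hb.trans_le hb') (by positivity)

/-- Two points with equal times would share a cell of every grid, and a bounded time interval is
covered by finitely many cells with at most one point each. -/
lemma exists_enumeration (hω : ω ∈ goodEvent Pts T m R) :
    ∃ p : ℕ → E, StrictMono (fun k => T (p k)) ∧ range p = Pts ω ∩ R ∧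
      Tendsto (fun k => T (p k)) atTop atTop := by
  refine _root_.exists_enumeration (fun e he e' he' heq => ?_) (fun b => ?_) fun b => ?_
  · obtain ⟨d, N, hd, hN⟩ := exists_partition hω (T e + 1)
    refine encard_le_one_iff.1 (hd _ (hN e he (lt_add_one _))) e e' ⟨he.1, ?_⟩ ⟨he'.1, ?_⟩
    · exact (mem_gridCell_iff (nonneg hω he)).2 ⟨he.2, rfl, mem_univ _⟩
    · exact (mem_gridCell_iff (nonneg hω he')).2 ⟨he'.2, by rw [heq], mem_univ _⟩
  · obtain ⟨d, N, hd, hN⟩ := exists_partition hω b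
    refine ((finite_lt_nat N).biUnion (t := fun j => Pts ω ∩ gridCell T m R d j univ)
      fun j hj => finite_of_encard_le_coe (k := 1) (hd j hj)).subset ?_
    rintro e ⟨he, hb⟩
    exact mem_biUnion (hN e he hb)
      ⟨he.1, (mem_gridCell_iff (nonneg hω he)).2 ⟨he.2, rfl, mem_univ _⟩⟩
  · obtain ⟨b', hb'⟩ := exists_nat_ge b
    obtain ⟨e, he, heR, hb⟩ := encard_ne_zero.1 (hω.2.1 b')
    exact ⟨e, ⟨he, heR⟩, hb'.trans hb⟩

end goodEvent

lemma CellPattern.to_univ {c : ℕ → ℕ} {x : ℕ → M} {s : Finset ℕ} {B : ℕ → Set M}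
    (h : CellPattern c x s B) : CellPattern c x s fun _ => univ := by
  intro j hj
  obtain ⟨h1, h2⟩ := h j hj
  refine ⟨?_, by simp⟩
  rw [← h1]
  congr 1
  ext k
  simp only [mem_univ, and_true, mem_ofPred_eq, iff_self_and]
  intro hk
  by_contra hx
  rw [encard_eq_zero] at h2
  exact (h2.subset ⟨hk, hx⟩ :)

/-- Some pattern of `n` occupied cells occurs, with conditions on the first `n` marks. -/
def patternEvent (Pts : Ω → Set E) (T : E → ℝ) (m : E → M) (R : Set E) (n d : ℕ)
    (B : ℕ → Set M) : Set Ω :=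
  ⋃ s : {s : Finset ℕ // s.card = n}, gridEvent Pts T m R d s B

/-- On a grid separating the first `n + 1` points, their first `n` cells form a pattern, and every
pattern of size `n` sees the first `n` marks. The threshold for `d` does not depend on `B`. -/
lemma eventually_mem_patternEvent_iff {ω : Ω} {p : ℕ → E} (hp : StrictMono fun k => T (p k))
    (hr : range p = Pts ω ∩ R) (h0 : ∀ k, 0 ≤ T (p k)) (n : ℕ) :
    ∀ᶠ d in atTop, ∀ B : ℕ → Set M,
      (ω ∈ patternEvent Pts T m R n d B ↔ ∀ l < n, m (p l) ∈ B l) := by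
  filter_upwards [eventually_lt_cellIndex hp h0 n] with d hd B
  have hmono := monotone_cellIndex hp d
  obtain ⟨hcard, hpat⟩ := CellPattern.of_strictMono (fun k => m (p k)) hmono hd
  simp only [patternEvent, mem_iUnion, Subtype.exists, mem_gridEvent_iff hp hr h0]
  constructor
  · rintro ⟨s, hs, h⟩
    have huniv := h.to_univ
    have := (huniv.iff_forall_mem hmono B).1 h
    rwa [hs] at this
  · intro h
    refine ⟨_, hcard, (hpat.iff_forall_mem hmono B).2 ?_⟩
    rwa [hcard]

variable [MeasurableSpace Ω] [MeasurableSpace E] [MeasurableSpace M] {Λ : Measure E}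
  {P : Measure Ω} {r : ℝ} {ρ : Measure M}

namespace IsMarkedRegion

lemma measure_gridCell_univ [IsProbabilityMeasure ρ] (hR : IsMarkedRegion Λ T m R r ρ) (d j : ℕ) :
    Λ (gridCell T m R d j univ) = ENNReal.ofReal (r / (d + 1)) := by
  simpa using hR.measure_gridCell d j .univ

lemma measure_no_points_after [IsProbabilityMeasure ρ] (hR : IsMarkedRegion Λ T m R r ρ)
    (hPts : IsPoissonProcess Pts Λ P) (b : ℕ) :
    P {ω | (Pts ω ∩ {e | e ∈ R ∧ (b : ℝ) ≤ T e}).encard = 0} = 0 := by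
  have hr := hR.pos
  have hlim : Tendsto (fun k : ℕ => ENNReal.ofReal (Real.exp (-(r * k)))) atTop (𝓝 0) := by
    rw [← ENNReal.ofReal_zero]
    refine ENNReal.tendsto_ofReal (Real.tendsto_exp_neg_atTop_nhds_zero.comp ?_)
    exact tendsto_natCast_atTop_atTop.const_mul_atTop hr
  refine le_antisymm (ge_of_tendsto' hlim fun k => ?_) zero_le
  rw [← hPts.measure_count_eq_zero (B := timeCell T m R b (b + k) univ)
    (hR.measurableSet_timeCell _ _ .univ) (by positivity)
    (by rw [hR.measure_cell _ _ (by positivity) (by simp) _ .univ]; simp)]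
  refine measure_mono fun ω (hω : _ = _) => ?_
  rw [encard_eq_zero] at hω
  change _ = _
  rw [encard_eq_zero, eq_empty_iff_forall_notMem]
  rintro e ⟨he, heR, hT, -⟩
  exact (hω.subset ⟨he, heR, hT.1⟩ :)

/-- There are `b (d + 1)` cells, each doubly occupied with probability at most `(r / (d + 1)) ^ 2`;
the union bound is of order `1 / (d + 1)`. -/
lemma measure_not_separated [IsProbabilityMeasure P] [IsProbabilityMeasure ρ]
    (hR : IsMarkedRegion Λ T m R r ρ) (hPts : IsPoissonProcess Pts Λ P) (b : ℕ) :
    P {ω | ¬ ∃ d : ℕ, ∀ j < b * (d + 1), (Pts ω ∩ gridCell T m R d j univ).encard ≤ 1} = 0 := by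
  have hr := hR.pos
  have hlim : Tendsto (fun d : ℕ => ENNReal.ofReal (b * r ^ 2 * (1 / ((d : ℝ) + 1)))) atTop
      (𝓝 0) := by
    rw [← ENNReal.ofReal_zero]
    refine ENNReal.tendsto_ofReal ?_
    simpa using (tendsto_one_div_add_atTop_nhds_zero_nat (𝕜 := ℝ)).const_mul (b * r ^ 2)
  refine le_antisymm (ge_of_tendsto' hlim fun d => ?_) zero_le
  calc _ ≤ P (⋃ j ∈ Finset.range (b * (d + 1)),
        {ω | ¬ (Pts ω ∩ gridCell T m R d j univ).encard ≤ 1}) := by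
        refine measure_mono fun ω hω => ?_
        have : ¬ ∀ j < b * (d + 1), (Pts ω ∩ gridCell T m R d j univ).encard ≤ 1 :=
          fun h => hω ⟨d, h⟩
        push Not at this
        obtain ⟨j, hj, h⟩ := this
        exact mem_biUnion (Finset.mem_range.2 hj) (not_le.2 h)
    _ ≤ ∑ j ∈ Finset.range (b * (d + 1)),
        P {ω | ¬ (Pts ω ∩ gridCell T m R d j univ).encard ≤ 1} := measure_biUnion_finset_le _ _
    _ ≤ ∑ j ∈ Finset.range (b * (d + 1)), ENNReal.ofReal ((r / (d + 1)) ^ 2) :=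
        Finset.sum_le_sum fun j _ => hPts.measure_not_count_le_one
          (hR.measurableSet_timeCell _ _ .univ) (by positivity) (hR.measure_gridCell_univ d j)
    _ = ENNReal.ofReal (b * r ^ 2 * (1 / ((d : ℝ) + 1))) := by
        rw [Finset.sum_const, Finset.card_range, nsmul_eq_mul, ← ENNReal.ofReal_natCast,
          ← ENNReal.ofReal_mul (by positivity)]
        congr 1
        push_cast
        field_simp

lemma ae_mem_goodEvent [IsProbabilityMeasure P] [IsProbabilityMeasure ρ]
    (hR : IsMarkedRegion Λ T m R r ρ) (hPts : IsPoissonProcess Pts Λ P) :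
    ∀ᵐ ω ∂P, ω ∈ goodEvent Pts T m R := by
  have h1 : ∀ᵐ ω ∂P, (Pts ω ∩ {e | e ∈ R ∧ T e < 0}).encard = 0 := by
    have hm : MeasurableSet {e | e ∈ R ∧ T e < 0} :=
      hR.measurableSet.inter (hR.measurable_time measurableSet_Iio)
    have := hPts.measure_count_eq_zero hm le_rfl (by rw [hR.measure_neg]; simp)
    rw [neg_zero, Real.exp_zero, ENNReal.ofReal_one] at this
    exact (prob_compl_eq_zero_iff (hPts.measurableSet_count hm 0)).2 this
  have h2 : ∀ᵐ ω ∂P, ∀ b : ℕ, (Pts ω ∩ {e | e ∈ R ∧ (b : ℝ) ≤ T e}).encard ≠ 0 :=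
    ae_all_iff.2 fun b => by
      rw [ae_iff]
      simpa only [not_not] using hR.measure_no_points_after hPts b
  have h3 : ∀ᵐ ω ∂P, ∀ b : ℕ, ∃ d : ℕ, ∀ j < b * (d + 1),
      (Pts ω ∩ gridCell T m R d j univ).encard ≤ 1 :=
    ae_all_iff.2 fun b => hR.measure_not_separated hPts b
  filter_upwards [h1, h2, h3] with ω a1 a2 a3
  exact ⟨a1, a2, a3⟩

lemma measurableSet_patternEvent (hR : IsMarkedRegion Λ T m R r ρ)
    (hPts : IsPoissonProcess Pts Λ P) (n d : ℕ) {B : ℕ → Set M} (hB : ∀ i, MeasurableSet (B i)) :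
    MeasurableSet (patternEvent Pts T m R n d B) :=
  .iUnion fun s => hR.measurableSet_gridEvent hPts d s hB

/-- For each pattern the mark factor is the same product over ranks, so it comes out of the sum over
patterns. -/
lemma measure_patternEvent [IsProbabilityMeasure P] [IsProbabilityMeasure ρ]
    (hR : IsMarkedRegion Λ T m R r ρ)
    (hPts : IsPoissonProcess Pts Λ P) (n d : ℕ) {B : ℕ → Set M} (hB : ∀ i, MeasurableSet (B i)) :
    P (patternEvent Pts T m R n d B) =
      (∏ l ∈ Finset.range n, ρ (B l)) * P (patternEvent Pts T m R n d fun _ => univ) := by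
  have key : ∀ {B : ℕ → Set M}, (∀ i, MeasurableSet (B i)) → P (patternEvent Pts T m R n d B) =
      ∑' s : {s : Finset ℕ // s.card = n}, P (gridEvent Pts T m R d s B) := by
    intro B hB
    -- Exclusivity of patterns relies on an enumeration of the points, hence disjointness only up to
    -- a null set.
    refine measure_iUnion₀ ?_ fun s => (hR.measurableSet_gridEvent hPts d s hB).nullMeasurableSet
    have hz : P (goodEvent Pts T m R)ᶜ = 0 := hR.ae_mem_goodEvent hPts
    refine fun s s' hss => measure_mono_null (t := (goodEvent Pts T m R)ᶜ)
      (fun ω hω hG => hss ?_) hz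
    obtain ⟨p, hp, hr, -⟩ := goodEvent.exists_enumeration hG
    have h0 : ∀ k, 0 ≤ T (p k) := fun k => goodEvent.nonneg hG (hr ▸ mem_range_self k)
    simp only [mem_inter_iff, mem_gridEvent_iff hp hr h0] at hω
    exact Subtype.ext (hω.1.to_univ.unique (monotone_cellIndex hp d) hω.2.to_univ
      (s.2.trans s'.2.symm))
  rw [key hB, key fun _ => .univ, ← ENNReal.tsum_mul_left]
  refine tsum_congr fun s => ?_
  rw [hR.measure_gridEvent hPts d s hB, hR.measure_gridEvent hPts d s fun _ => .univ]
  simp [s.2]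

/-- The marks of a marked Poisson process, in the order of the times, are i.i.d. -/
theorem exists_iid_marks [IsProbabilityMeasure P] [IsProbabilityMeasure ρ]
    (hR : IsMarkedRegion Λ T m R r ρ) (hPts : IsPoissonProcess Pts Λ P) :
    ∃ W : Ω → ℕ → M, Measurable W ∧ P.map W = Measure.infinitePi (fun _ : ℕ => ρ) ∧
      ∀ᵐ ω ∂P, ∃ p : ℕ → E, StrictMono (fun k => T (p k)) ∧ range p = Pts ω ∩ R ∧
        Tendsto (fun k => T (p k)) atTop atTop ∧ W ω = fun k => m (p k) := by
  classical
  obtain ⟨x₀⟩ : Nonempty M := ρ.nonempty_of_neZero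
  have hex : ∀ ω, ∃ p : ℕ → E, ω ∈ goodEvent Pts T m R → StrictMono (fun k => T (p k)) ∧
      range p = Pts ω ∩ R ∧ Tendsto (fun k => T (p k)) atTop atTop := fun ω => by
    by_cases hω : ω ∈ goodEvent Pts T m R
    · obtain ⟨p, hp⟩ := goodEvent.exists_enumeration hω
      exact ⟨p, fun _ => hp⟩
    · obtain ⟨e⟩ : Nonempty E := by
        obtain ⟨ω', hω'⟩ := (hR.ae_mem_goodEvent hPts).exists
        obtain ⟨p, -⟩ := goodEvent.exists_enumeration hω'
        exact ⟨p 0⟩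
      exact ⟨fun _ => e, fun h => absurd h hω⟩
  choose p hp using hex
  let G := goodEvent Pts T m R
  have hG : MeasurableSet G := hR.measurableSet_goodEvent hPts
  let W : Ω → ℕ → M := fun ω k => if ω ∈ G then m (p ω k) else x₀
  have hev : ∀ ω ∈ G, ∀ n, ∀ᶠ d in atTop, ∀ B : ℕ → Set M,
      (ω ∈ patternEvent Pts T m R n d B ↔ ∀ l < n, m (p ω l) ∈ B l) := fun ω hω n =>
    eventually_mem_patternEvent_iff (hp ω hω).1 (hp ω hω).2.1
      (fun k => goodEvent.nonneg hω ((hp ω hω).2.1 ▸ mem_range_self k)) n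
  have hmeas : ∀ (n : ℕ) (B : ℕ → Set M), (∀ i, MeasurableSet (B i)) →
      MeasurableSet {ω | ω ∈ G ∧ ∀ l < n, m (p ω l) ∈ B l} := by
    intro n B hB
    -- The enumeration `p` is chosen without regard to measurability; expressing the event as a
    -- lower limit of pattern events restores it.
    have : {ω | ω ∈ G ∧ ∀ l < n, m (p ω l) ∈ B l} =
        G ∩ liminf (fun d => patternEvent Pts T m R n d B) atTop := by
      ext ω
      simp only [mem_ofPred_eq, mem_inter_iff, mem_liminf_iff_eventually_mem, and_congr_right_iff]
      intro hω
      constructor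
      · exact fun h => (hev ω hω n).mono fun d hd => (hd B).2 h
      · intro h
        obtain ⟨d, h1, h2⟩ := (h.and (hev ω hω n)).exists
        exact (h2 B).1 h1
    rw [this]
    exact hG.inter (MeasurableSet.measurableSet_liminf fun d =>
      hR.measurableSet_patternEvent hPts n d hB)
  have hW : Measurable W := by
    refine measurable_pi_lambda _ fun k B hB => ?_
    have : (fun ω => W ω k) ⁻¹' B = {ω | ω ∈ G ∧ ∀ l < k + 1, m (p ω l) ∈
        (if l = k then B else univ)} ∪ (Gᶜ ∩ {_ω | x₀ ∈ B}) := by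
      ext ω
      simp only [W, mem_preimage, mem_union, mem_ofPred_eq, mem_inter_iff, mem_compl_iff]
      by_cases hω : ω ∈ G
      · simp only [hω, if_true, true_and, not_true, false_and, or_false]
        refine ⟨fun h l _ => ?_, fun h => by simpa using h k k.lt_succ_self⟩
        split_ifs with hl
        exacts [hl ▸ h, mem_univ _]
      · simp [hω]
    rw [this]
    refine (hmeas (k + 1) (fun l => if l = k then B else univ) fun l => ?_).union
      (hG.compl.inter (.const _))
    split_ifs
    exacts [hB, .univ]
  refine ⟨W, hW, ?_, ?_⟩
  · refine eq_infinitePi_of_range ρ fun n t ht => ?_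
    rw [Measure.map_apply hW (measurableSet_range_box n ht)]
    have hlim : ∀ B : ℕ → Set M, (∀ i, MeasurableSet (B i)) →
        Tendsto (fun d => P (patternEvent Pts T m R n d B)) atTop
          (𝓝 (P {ω | ω ∈ G ∧ ∀ l < n, m (p ω l) ∈ B l})) := fun B hB => by
      refine tendsto_measure_of_ae_tendsto_indicator_of_isFiniteMeasure atTop (hmeas n B hB)
        (fun d => hR.measurableSet_patternEvent hPts n d hB) ?_
      filter_upwards [hR.ae_mem_goodEvent hPts] with ω hω
      filter_upwards [hev ω hω n] with d hd
      rw [hd B]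
      exact ⟨fun h => ⟨hω, h⟩, fun h => h.2⟩
    have h1 : P {ω | ω ∈ G ∧ ∀ l < n, m (p ω l) ∈ (univ : Set M)} = 1 := by
      simp only [mem_univ, implies_true, and_true]
      exact (prob_compl_eq_zero_iff hG).1 (hR.ae_mem_goodEvent hPts)
    have h2 := hlim (fun _ => univ) fun _ => .univ
    rw [h1] at h2
    -- Some pattern of size `n` occurs with probability tending to `1`, so the mark factor alone
    -- survives in the limit.
    have h3 := ENNReal.Tendsto.const_mul (a := ∏ l ∈ Finset.range n, ρ (t l)) h2
      (Or.inl one_ne_zero)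
    simp only [← hR.measure_patternEvent hPts n _ ht, mul_one] at h3
    rw [← tendsto_nhds_unique (hlim t ht) h3]
    refine measure_congr ?_
    filter_upwards [hR.ae_mem_goodEvent hPts] with ω hω
    have hω' : ω ∈ G := hω
    refine propext ?_
    change (∀ i < n, (if ω ∈ G then m (p ω i) else x₀) ∈ t i) ↔
      (ω ∈ G ∧ ∀ l < n, m (p ω l) ∈ t l)
    simp only [hω', if_true, true_and]
  · filter_upwards [hR.ae_mem_goodEvent hPts] with ω hω
    refine ⟨p ω, (hp ω hω).1, (hp ω hω).2.1, (hp ω hω).2.2, ?_⟩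
    funext k
    exact if_pos hω

end IsMarkedRegion

end MarkedProcesses

/-! ### The sieve at two levels -/

lemma IsTimeEnum.unique {S : Set (ℝ × ℝ × LipFun)} {p q : ℕ → ℝ × ℝ × LipFun}
    (hp : IsTimeEnum S p) (hq : IsTimeEnum S q) : p = q := by
  have htime : (fun k => (p k).1) = fun k => (q k).1 := by
    refine (StrictMono.range_inj hp.1 hq.1).1 ?_
    have hrange : ∀ p : ℕ → ℝ × ℝ × LipFun, range (fun k => (p k).1) = Prod.fst '' range p :=
      fun p => range_comp Prod.fst p
    rw [hrange, hrange, hp.2, hq.2]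
  funext k
  obtain ⟨j, hj⟩ : p k ∈ range q := by
    rw [hq.2, ← hp.2]
    exact mem_range_self k
  have : (q j).1 = (q k).1 := by
    rw [hj]
    exact congrFun htime k
  rw [← hj, hq.1.injective this]

lemma timeEnum_eq {S : Set (ℝ × ℝ × LipFun)} {p : ℕ → ℝ × ℝ × LipFun} (hp : IsTimeEnum S p) :
    timeEnum S = p := by
  have h : ∃ p, IsTimeEnum S p := ⟨p, hp⟩
  rw [timeEnum, dif_pos h]
  exact h.choose_spec.unique hp

/-- Divergence of the times is also needed to bound the set for fixed `t`, as the supremum of an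
unbounded set of naturals is `0`. -/
lemma tendsto_sSup_times {τ : ℕ → ℝ} (hτ : Tendsto τ atTop atTop) :
    Tendsto (fun t : ℝ => sSup {n : ℕ | ∃ k : ℕ, n = k + 1 ∧ τ k ≤ t}) atTop atTop := by
  refine tendsto_atTop.2 fun n => ?_
  filter_upwards [eventually_ge_atTop (τ n)] with t ht
  obtain ⟨b, hb⟩ := eventually_atTop.1 (hτ.eventually_gt_atTop t)
  have hbdd : BddAbove {n : ℕ | ∃ k : ℕ, n = k + 1 ∧ τ k ≤ t} := by
    refine ⟨b, ?_⟩
    rintro _ ⟨k, rfl, hk⟩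
    by_contra hlt
    exact absurd hk (hb k (by omega)).not_ge
  exact (Nat.le_succ n).trans (le_csSup hbdd ⟨n, rfl, ht⟩)

/-- The sieved limit is the infinite iteration of the functions in the order of their times. -/
lemma zeta_eq {S : Set (ℝ × ℝ × LipFun)} {p : ℕ → ℝ × ℝ × LipFun} {x z₀ l : ℝ}
    (hp : IsTimeEnum (pointsOver S (Icc 0 x)) p) (ht : Tendsto (fun k => (p k).1) atTop atTop)
    (hl : Tendsto (fun n => backIter (fun k => (p k).2.2) n z₀) atTop (𝓝 l)) :
    zeta z₀ S x = l := by
  rw [zeta]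
  refine Tendsto.limUnder_eq ?_
  simp only [sievedIter, timeEnum_eq hp]
  exact hl.comp (tendsto_sSup_times ht)

/-- The label `x / y` in the unit interval and the function of a point `(t, x, f)`. -/
noncomputable def sieveMark (y : ℝ) (q : ℝ × ℝ × LipFun) : unitInterval × LipFun :=
  (projIcc 0 1 zero_le_one (q.2.1 / y), q.2.2)

/-- A label is at most `a` exactly when the second coordinate is at most `a * y`, so thinning by
labels lowers the level. -/
lemma IsTimeEnum.comp_nth {S : Set (ℝ × ℝ × LipFun)} {p : ℕ → ℝ × ℝ × LipFun} {y a : ℝ}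
    (hy : 0 < y) (ha : a ≤ 1) (hp : IsTimeEnum (pointsOver S (Icc 0 y)) p)
    (hinf : {k | ((sieveMark y (p k)).1 : ℝ) ≤ a}.Infinite) :
    IsTimeEnum (pointsOver S (Icc 0 (a * y)))
      (fun j => p (Nat.nth (fun k => ((sieveMark y (p k)).1 : ℝ) ≤ a) j)) := by
  have hlabel : ∀ k, ((sieveMark y (p k)).1 : ℝ) ≤ a ↔ (p k).2.1 ≤ a * y := fun k => by
    have hk : p k ∈ pointsOver S (Icc 0 y) := hp.2 ▸ mem_range_self k
    have hmem : (p k).2.1 / y ∈ Icc (0 : ℝ) 1 :=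
      ⟨div_nonneg hk.2.1 hy.le, (div_le_one hy).2 hk.2.2⟩
    rw [sieveMark, projIcc_of_mem _ hmem, div_le_iff₀ hy]
  refine ⟨hp.1.comp (Nat.nth_strictMono hinf), ?_⟩
  have h1 : range (fun j => p (Nat.nth (fun k => ((sieveMark y (p k)).1 : ℝ) ≤ a) j)) =
      p '' {k | ((sieveMark y (p k)).1 : ℝ) ≤ a} := by
    rw [← Nat.range_nth_of_infinite hinf, ← range_comp]
    rfl
  rw [h1]
  ext q
  constructor
  · rintro ⟨k, hk, rfl⟩
    have hmem : p k ∈ pointsOver S (Icc 0 y) := hp.2 ▸ mem_range_self k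
    exact ⟨hmem.1, hmem.2.1, (hlabel k).1 hk⟩
  · rintro ⟨hq, hq0, hqa⟩
    have : q ∈ range p := by
      rw [hp.2]
      exact ⟨hq, hq0, hqa.trans (mul_le_of_le_one_left hy.le ha)⟩
    obtain ⟨k, rfl⟩ := this
    exact ⟨k, (hlabel k).2 hqa, rfl⟩

lemma map_projIcc_volume {y : ℝ} (hy : 0 < y) :
    ((volume : Measure ℝ).restrict (Icc 0 y)).map (fun x => projIcc 0 1 zero_le_one (x / y)) =
      ENNReal.ofReal y • (volume : Measure unitInterval) := by
  have hm : Measurable fun x : ℝ => projIcc (0 : ℝ) 1 zero_le_one (x / y) :=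
    continuous_projIcc.measurable.comp (by fun_prop)
  ext A hA
  have hset : (fun x : ℝ => projIcc (0 : ℝ) 1 zero_le_one (x / y)) ⁻¹' A ∩ Icc 0 y =
      (fun x => y⁻¹ * x) ⁻¹' (Subtype.val '' A) := by
    ext x
    have hiff : x ∈ Icc 0 y ↔ y⁻¹ * x ∈ Icc (0 : ℝ) 1 := by
      rw [mem_Icc, mem_Icc, inv_mul_le_iff₀ hy, mul_one, mul_nonneg_iff_of_pos_left (inv_pos.2 hy)]
    simp only [mem_inter_iff, mem_preimage, mem_image, Subtype.exists, exists_and_right,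
      exists_eq_right]
    rw [hiff, div_eq_inv_mul]
    constructor
    · rintro ⟨h1, h2⟩
      exact ⟨h2, by rwa [projIcc_of_mem _ h2] at h1⟩
    · rintro ⟨h2, h1⟩
      exact ⟨by rwa [projIcc_of_mem _ h2], h2⟩
  rw [Measure.map_apply hm hA, Measure.restrict_apply (hm hA), hset,
    Real.volume_preimage_mul_left (inv_ne_zero hy.ne'), inv_inv, abs_of_pos hy,
    ← unitInterval.volume_apply, Measure.smul_apply, smul_eq_mul]

section Sieve

variable [MeasurableSpace LipFun]

lemma measurable_sieveMark (y : ℝ) : Measurable (sieveMark y) :=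
  (continuous_projIcc.measurable.comp (by fun_prop)).prodMk (by fun_prop)

/-- Rescaling `[0, y]` to the unit interval turns its Lebesgue measure into `y` times the uniform
law: `y` becomes the rate in time, and labels are uniform and independent of the functions. -/
lemma isMarkedRegion_sieve (ν : Measure LipFun) [IsProbabilityMeasure ν] {y : ℝ} (hy : 0 < y) :
    IsMarkedRegion (sieveIntensity ν) Prod.fst (sieveMark y) {q | q.2.1 ∈ Icc 0 y} y
      ((volume : Measure unitInterval).prod ν) where
  measurable_time := measurable_fst
  measurable_mark := measurable_sieveMark y
  measurableSet := measurableSet_Icc.preimage (by fun_prop)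
  pos := hy
  measure_cell a b ha hab B hB := by
    have hm : Measurable fun x : ℝ => projIcc (0 : ℝ) 1 zero_le_one (x / y) :=
      continuous_projIcc.measurable.comp (by fun_prop)
    have hset : timeCell Prod.fst (sieveMark y) {q : ℝ × ℝ × LipFun | q.2.1 ∈ Icc 0 y} a b B =
        Ico a b ×ˢ ((Icc 0 y ×ˢ univ) ∩
          (Prod.map (fun x : ℝ => projIcc (0 : ℝ) 1 zero_le_one (x / y)) id) ⁻¹' B) := by
      ext ⟨t, x, f⟩
      simp only [timeCell, sieveMark, mem_ofPred_eq, mem_prod, mem_inter_iff, mem_univ, and_true,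
        mem_preimage, Prod.map, id]
      tauto
    have hIci : (volume : Measure ℝ).restrict (Ici 0) (Ico a b) = ENNReal.ofReal (b - a) := by
      rw [Measure.restrict_apply measurableSet_Ico, inter_eq_left.2, Real.volume_Ico]
      exact fun t ht => ha.trans ht.1
    have hmarks : (((volume : Measure ℝ).restrict (Ici 0)).prod ν) ((Icc 0 y ×ˢ univ) ∩
        (Prod.map (fun x : ℝ => projIcc (0 : ℝ) 1 zero_le_one (x / y)) id) ⁻¹' B) =
        ENNReal.ofReal y * ((volume : Measure unitInterval).prod ν) B := by
      rw [inter_comm, ← Measure.restrict_apply ((hm.prodMap measurable_id) hB),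
        ← Measure.prod_restrict, Measure.restrict_univ,
        Measure.restrict_restrict measurableSet_Icc, inter_eq_left.2 Icc_subset_Ici_self,
        ← Measure.map_apply (hm.prodMap measurable_id) hB, ← Measure.map_prod_map _ _ hm
          measurable_id, map_projIcc_volume hy, Measure.map_id, Measure.prod_smul_left,
        Measure.smul_apply, smul_eq_mul]
    rw [hset, sieveIntensity, Measure.prod_prod, hIci, hmarks, ← mul_assoc,
      ← ENNReal.ofReal_mul (sub_nonneg.2 hab), mul_comm (b - a)]
  measure_neg := by
    refine measure_mono_null (t := Iio (0 : ℝ) ×ˢ univ) (fun q hq => ⟨hq.2, mem_univ _⟩) ?_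
    rw [sieveIntensity, Measure.prod_prod, Measure.restrict_apply measurableSet_Iio]
    have : Iio (0 : ℝ) ∩ Ici 0 = ∅ := by
      ext t
      simp
    simp [this]

/-- The sieved limits at the levels `e^{-δ} y` and `y` as limits of a subsequence and of the whole
of one i.i.d. sequence. -/
lemma exists_iid_representation {Ω : Type*} [MeasurableSpace Ω] {P : Measure Ω}
    [IsProbabilityMeasure P] {ν : Measure LipFun} [IsProbabilityMeasure ν] {c z₀ : ℝ} {K : Set ℝ}
    {𝓕 : Set LipFun} (H : ContractsOn c K 𝓕) (hν : ∀ᵐ f ∂ν, f ∈ 𝓕)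
    {Pts : Ω → Set (ℝ × ℝ × LipFun)} (hPts : IsPoissonProcess Pts (sieveIntensity ν) P)
    {y a : ℝ} (hy : 0 < y) (ha : 0 < a) (ha1 : a ≤ 1) :
    ∃ W : Ω → ℕ → unitInterval × LipFun, AEMeasurable W P ∧
      P.map W = Measure.infinitePi (fun _ : ℕ => (volume : Measure unitInterval).prod ν) ∧
      (∀ᵐ ω ∂P, zeta z₀ (Pts ω) (a * y) = keptLim z₀ a (W ω)) ∧
      ∀ᵐ ω ∂P, zeta z₀ (Pts ω) y = fullLim z₀ (W ω) := by
  obtain ⟨W, hW, hlaw, hae⟩ := (isMarkedRegion_sieve ν hy).exists_iid_marks hPts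
  have hmem : ∀ᵐ ω ∂P, ∀ k, (W ω k).2 ∈ 𝓕 := by
    have := ae_forall_snd_mem hν
    rw [← hlaw] at this
    exact ae_of_ae_map hW.aemeasurable this
  have hinf : ∀ᵐ ω ∂P, {k | ((W ω k).1 : ℝ) ≤ a}.Infinite := by
    have := ae_infinite_fst_le (ν := ν) ha
    rw [← hlaw] at this
    exact ae_of_ae_map hW.aemeasurable this
  refine ⟨W, hW.aemeasurable, hlaw, ?_, ?_⟩
  · filter_upwards [hae, hmem, hinf] with ω ⟨p, hp, hr, ht, hWp⟩ hm hi
    have hpe : IsTimeEnum (pointsOver (Pts ω) (Icc 0 y)) p := ⟨hp, hr⟩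
    rw [hWp] at hm hi
    rw [hWp, keptLim, H.backLim_deleteSeq z₀ hm hi]
    exact zeta_eq (hpe.comp_nth hy ha1 hi)
      (ht.comp (Nat.nth_strictMono hi).tendsto_atTop) (H.tendsto_backLim (fun j => hm _) z₀ z₀)
  · filter_upwards [hae, hmem] with ω ⟨p, hp, hr, ht, hWp⟩ hm
    rw [hWp] at hm
    rw [hWp, fullLim]
    exact zeta_eq (⟨hp, hr⟩ : IsTimeEnum (pointsOver (Pts ω) (Icc 0 y)) p) ht
      (H.tendsto_backLim hm z₀ z₀)

end Sieve

/-! ### The theorem -/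

theorem mainTheorem9
    {Ω : Type*} [MeasurableSpace Ω] (P : Measure Ω) [IsProbabilityMeasure P]
    [MeasurableSpace LipFun] (hev : ∀ x : ℝ, Measurable (fun f : LipFun => f x))
    (ν : Measure LipFun) [IsProbabilityMeasure ν] (z₀ : ℝ)
    (hint : Integrable (fun f : LipFun => |f z₀ - z₀|) ν)
    (Pts : Ω → Set (ℝ × ℝ × LipFun)) (hPts : IsPoissonProcess Pts (sieveIntensity ν) P)
    (K : Set ℝ) (hK : K = (limitLaw ν z₀).support) (hcompact : IsCompact K)
    (𝓕 : Set LipFun) (g : ℝ → ℕ → LipFun) (hrec : HasRecovery ν z₀ K 𝓕 g)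
    (c : ℝ) (hc1 : c < 1) (hc : ∀ f ∈ 𝓕, f.lipConst ≤ c) :
    -- transition laws of `ζ(e^t)`, forward and reverse
    (∀ t δ : ℝ, 0 < δ →
      IsCondLawOn P (fun ω => zeta z₀ (Pts ω) (Real.exp (t + δ)))
        (fun ω => zeta z₀ (Pts ω) (Real.exp t)) K (fun z => insertLaw ν z₀ δ (g z)) ∧
      IsCondLawOn P (fun ω => zeta z₀ (Pts ω) (Real.exp (t - δ)))
        (fun ω => zeta z₀ (Pts ω) (Real.exp t)) K (fun z => deleteLaw z₀ δ (g z))) ∧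
    -- the inverses in the two series make sense
    (∀ z ∈ K, ∀ k : ℕ, InjOn (g z k) K ∧ InjOn (backIter (g z) k) K ∧
      z ∈ backIter (g z) k '' K ∧
      Function.invFunOn (backIter (g z) k) K z ∈ g z k '' K) ∧
    -- the generators
    (∀ h : ℝ → ℝ, ContDiffOn ℝ 1 h K → ∀ z ∈ K,
      (∀ k, Integrable (fun f : LipFun => h (conjInsert K (g z) k f z)) ν) ∧
      Summable (fun k : ℕ => (∫ f, h (conjInsert K (g z) k f z) ∂ν) - h z) ∧
      IsGeneratorValue (fun δ z => insertLaw ν z₀ δ (g z)) h z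
        (∑' k : ℕ, ((∫ f, h (conjInsert K (g z) k f z) ∂ν) - h z)) ∧
      Summable (fun k : ℕ => h (conjDelete K (g z) k z) - h z) ∧
      IsGeneratorValue (fun δ z => deleteLaw z₀ δ (g z)) h z
        (∑' k : ℕ, (h (conjDelete K (g z) k z) - h z))) := by
  have hne : K.Nonempty := hK ▸ support_limitLaw_nonempty hev ν z₀
  have H := hrec.contractsOn hcompact hne hc1 hc
  refine ⟨fun t δ hδ => ⟨?_, ?_⟩, fun z hz k => ⟨hrec.injOn H (hrec.mem z hz k),
    hrec.injOn_backIter H (hrec.mem z hz) k, hrec.mem_image_backIter H hz k,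
    hrec.invFunOn_mem_image H hz k⟩, fun h hh z hz => generators hev hrec H hh hz⟩
  -- The full level is the higher of the two: `e^{t+δ}` here, with `e^t` as its thinning, and `e^t`
  -- in the reverse case, with `e^{t-δ}` as its thinning.
  · obtain ⟨W, hW, hlaw, hX, hY⟩ := exists_iid_representation (z₀ := z₀) H hrec.ae_mem hPts
      (Real.exp_pos (t + δ)) (Real.exp_pos (-δ)) (Real.exp_le_one_iff.2 (neg_nonpos.2 hδ.le))
    rw [← Real.exp_add, show -δ + (t + δ) = t by ring] at hX
    exact isCondLawOn_insertLaw hev hrec H hW hlaw hX hY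
  · obtain ⟨W, hW, hlaw, hX, hY⟩ := exists_iid_representation (z₀ := z₀) H hrec.ae_mem hPts
      (Real.exp_pos t) (Real.exp_pos (-δ)) (Real.exp_le_one_iff.2 (neg_nonpos.2 hδ.le))
    rw [← Real.exp_add, show -δ + t = t - δ by ring] at hX
    exact isCondLawOn_deleteLaw hev hrec H hW hlaw hX hY
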